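/- **Conventions.** An A-space is a topological space in which arbitrary intersections of open sets are open; it is preordered by $x\le y$ iff $x$ lies in every open set containing $y$, and this is a partial order iff the space is $T_0$. A covering $p:E\to B$ is a surjective continuous map such that every point of $B$ has an evenly covered open neighbourhood; two coverings $p:E\to B$, $p':E'\to B$ are equivalent if there is a homeomorphism $h:E\to E'$ with $p'h=p$. A simplicial complex $K$ has a geometric realization $|K|$, endowed with the weak (coherent) topology; a simplicial map $\varphi:L\to K$ induces $|\varphi|:|L|\to|K|$ and is called a simplicial covering if $|\varphi|$ is a covering; a covering of $K$ means a covering of $|K|$. For a $T_0$ A-space $X$, the order complex $\mathcal K(X)$ is the simplicial complex of non-empty finite chains of $X$, and a continuous map $f:X\to Y$ of $T_0$ A-spaces induces a simplicial map $\mathcal K(f):\mathcal K(X)\to\mathcal K(Y)$ which is $f$ on vertices. For a simplicial complex $K$, the face poset $\mathcal X(K)$ is the set of simplices of $K$ ordered by inclusion, with the topology whose open sets are the down-sets; a simplicial map $\varphi:L\to K$ induces $\mathcal X(\varphi):\mathcal X(L)\to\mathcal X(K)$, $\sigma\mapsto\varphi(\sigma)$. **Theorem.** (1) Let $B$ be a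 $T_0$ A-space. If $p:E\to B$ is a covering, then $E$ is a $T_0$ A-space and $|\mathcal K(p)|:|\mathcal K(E)|\to|\mathcal K(B)|$ is a covering. Moreover, $[p]\mapsto[\,|\mathcal K(p)|\,]$ is a well-defined bijection from the equivalence classes of coverings of $B$ to the equivalence classes of coverings of $|\mathcal K(B)|$. (2) Let $K$ be a simplicial complex. If $\varphi:L\to K$ is a simplicial covering, then $\mathcal X(\varphi):\mathcal X(L)\to\mathcal X(K)$ is a covering. Moreover, every covering of $|K|$ is equivalent to $|\varphi|$ for some simplicial covering $\varphi:L\to K$, and $[\,|\varphi|\,]\mapsto[\mathcal X(\varphi)]$ is a well-defined bijection from the equivalence classes of coverings of $|K|$ to the equivalence classes of coverings of $\mathcal X(K)$. -/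

import Mathlib

universe u v

namespace PosetCov

open Topology

/-! ### Coverings and their equivalence classes -/

/-- A covering: every point of the base has an evenly covered open neighbourhood, and the map is
surjective (`IsCoveringMap` alone would allow empty fibres). -/
def IsCovering {E : Type v} {B : Type u} [TopologicalSpace E] [TopologicalSpace B]
    (p : E → B) : Prop :=
  IsCoveringMap p ∧ Function.Surjective p

/-- A covering of `B`, together with its total space. -/
structure Covering (B : Type u) [TopologicalSpace B] where
  /-- The total space. -/
  total : Type v
  /-- The topology of the total space. -/
  [top : TopologicalSpace total]
  /-- The covering map. -/
  proj : total → B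
  isCovering : IsCovering proj

attribute [instance] Covering.top

/-- Two coverings `p`, `p'` of `B` are equivalent if there is a homeomorphism `h` between their
total spaces such that `p' h = p`. -/
instance Covering.setoid (B : Type u) [TopologicalSpace B] : Setoid (Covering.{u, v} B) where
  r c c' := ∃ h : c.total ≃ₜ c'.total, ∀ e, c'.proj (h e) = c.proj e
  iseqv :=
    { refl := fun c => ⟨Homeomorph.refl _, fun _ => rfl⟩
      symm := by
        rintro c c' ⟨h, hh⟩
        refine ⟨h.symm, fun e => ?_⟩
        rw [← hh, h.apply_symm_apply]
      trans := by
        rintro c c' c'' ⟨h, hh⟩ ⟨k, hk⟩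
        exact ⟨h.trans k, fun e => (hk (h e)).trans (hh e)⟩ }

/-- Equivalence classes of coverings of `B`. -/
def CoveringClass (B : Type u) [TopologicalSpace B] : Type (max u (v + 1)) :=
  Quotient (Covering.setoid.{u, v} B)

/-- The equivalence class of a covering. -/
def CoveringClass.mk {B : Type u} [TopologicalSpace B] {E : Type v} [TopologicalSpace E]
    (p : E → B) (hp : IsCovering p) : CoveringClass.{u, v} B :=
  Quotient.mk (Covering.setoid.{u, v} B) ⟨E, p, hp⟩

/-! ### Simplicial maps -/

open Classical in
/-- A simplicial map: a map of vertices that sends simplices to simplices. -/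
structure SimplicialMap {W : Type v} {V : Type u} (L : AbstractSimplicialComplex W)
    (K : AbstractSimplicialComplex V) where
  /-- The map of vertices. -/
  toFun : W → V
  image_mem : ∀ s ∈ L, s.image toFun ∈ K

/-! ### Geometric realization -/

/-- The geometric realization `|K|`: its points are given by their barycentric coordinates. -/
@[ext]
structure Realization {V : Type u} (K : AbstractSimplicialComplex V) : Type u where
  /-- The barycentric coordinates. -/
  coord : V →₀ ℝ
  nonneg : ∀ v, 0 ≤ coord v
  sum_eq_one : (coord.sum fun _ a => a) = 1
  support_mem : coord.support ∈ K

/-- The closed simplex spanned by `s`, as a subset of `|K|`. -/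
def closedSimplex {V : Type u} (K : AbstractSimplicialComplex V) (s : Finset V) :
    Set (Realization K) :=
  {x | x.coord.support ⊆ s}

/-- The Euclidean topology of a closed simplex, i.e. the topology of convergence of the
barycentric coordinates. -/
@[reducible]
def closedSimplexTopology {V : Type u} (K : AbstractSimplicialComplex V) (s : Finset V) :
    TopologicalSpace (closedSimplex K s) :=
  TopologicalSpace.induced (fun x v => x.1.coord v) (inferInstanceAs (TopologicalSpace (V → ℝ)))

/-- The weak (coherent) topology of `|K|`: a set is open if and only if its intersection with every
closed simplex is open in that simplex. -/
instance {V : Type u} (K : AbstractSimplicialComplex V) : TopologicalSpace (Realization K) :=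
  ⨆ s : {s : Finset V // s ∈ K},
    TopologicalSpace.coinduced Subtype.val (closedSimplexTopology K s.1)

theorem realization_isOpen_iff {V : Type u} (K : AbstractSimplicialComplex V)
    (U : Set (Realization K)) :
    IsOpen U ↔ ∀ s ∈ K, ∃ O : Set (V → ℝ), IsOpen O ∧
      ∀ x : Realization K, x.coord.support ⊆ s → ((fun v => x.coord v) ∈ O ↔ x ∈ U) := by
  rw [isOpen_iSup_iff]
  simp only [isOpen_coinduced, Subtype.forall]
  refine forall₂_congr fun s _ => ?_
  refine exists_congr fun O => and_congr_right fun _ => ?_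
  constructor
  · intro h x hx
    exact Set.ext_iff.1 h ⟨x, hx⟩
  · intro h
    ext x
    exact h x.1 x.2

/-- The map `|φ| : |L| → |K|`, affine on simplices, induced by a simplicial map `φ`. -/
noncomputable def SimplicialMap.realization {W : Type v} {V : Type u}
    {L : AbstractSimplicialComplex W} {K : AbstractSimplicialComplex V} (φ : SimplicialMap L K)
    (x : Realization L) : Realization K :=
  have hsum : ((x.coord.mapDomain φ.toFun).sum fun _ a => a) = 1 := by
    rw [Finsupp.sum_mapDomain_index (fun _ => rfl) (fun _ _ _ => rfl)]
    exact x.sum_eq_one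
  { coord := x.coord.mapDomain φ.toFun
    nonneg := fun v => by
      classical
      rw [Finsupp.mapDomain, Finsupp.sum_apply]
      refine Finset.sum_nonneg fun a _ => ?_
      simp only [Finsupp.single_apply]
      split_ifs
      · exact x.nonneg a
      · exact le_rfl
    sum_eq_one := hsum
    support_mem := by
      classical
      refine (K.isRelLowerSet_faces (φ.image_mem _ x.support_mem)).2 ?_ ?_
      · convert Finsupp.mapDomain_support (f := φ.toFun) (s := x.coord)
      · rw [Finset.nonempty_iff_ne_empty]
        intro h
        rw [Finsupp.support_eq_empty] at h
        rw [h, Finsupp.sum_zero_index] at hsum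
        exact zero_ne_one hsum }

/-! ### The order complex functor -/

/-- The order complex `K(X)`: its simplices are the non-empty finite chains of `X`. The order of an
A-space `X` is `x ≤ y` iff `x` lies in every open set containing `y`, i.e. iff `x ⤳ y`; it is a
partial order if and only if `X` is T₀. -/
def orderComplex (X : Type u) [TopologicalSpace X] : AbstractSimplicialComplex X where
  faces := {s | s.Nonempty ∧ IsChain (fun x y : X => x ⤳ y) (s : Set X)}
  isRelLowerSet_faces := fun _ hs =>
    ⟨hs.1, fun _ hts ht => ⟨ht, hs.2.mono (Finset.coe_subset.2 hts)⟩⟩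
  singleton_mem v := ⟨Finset.singleton_nonempty v, by simp⟩

/-- The simplicial map `K(f) : K(X) → K(Y)` induced by a continuous map `f`. -/
def orderComplexMap {X : Type v} {Y : Type u} [TopologicalSpace X] [TopologicalSpace Y]
    (f : C(X, Y)) : SimplicialMap (orderComplex X) (orderComplex Y) where
  toFun := f
  image_mem s hs := by
    classical
    refine ⟨hs.1.image _, ?_⟩
    rw [Finset.coe_image]
    rintro _ ⟨a, ha, rfl⟩ _ ⟨b, hb, rfl⟩ hab
    have hne : a ≠ b := fun h => hab (congrArg f h)
    exact (hs.2 ha hb hne).imp (fun h => h.map f.continuous) (fun h => h.map f.continuous)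

/-! ### The face poset functor -/

/-- The face poset of `K`: the simplices of `K` ordered by inclusion. -/
@[ext]
structure FacePoset {V : Type u} (K : AbstractSimplicialComplex V) : Type u where
  /-- The set of vertices of the simplex. -/
  simplex : Finset V
  mem : simplex ∈ K

instance {V : Type u} (K : AbstractSimplicialComplex V) : PartialOrder (FacePoset K) :=
  PartialOrder.lift FacePoset.simplex fun _ _ => FacePoset.ext

/-- The topology with the sets `{τ | τ ≤ σ}` as a basis; its open sets are the lower sets. -/
instance {V : Type u} (K : AbstractSimplicialComplex V) : TopologicalSpace (FacePoset K) :=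
  Topology.lowerSet (FacePoset K)

open Classical in
/-- The map of face posets induced by a simplicial map, `σ ↦ φ(σ)`. -/
noncomputable def SimplicialMap.facePoset {W : Type v} {V : Type u}
    {L : AbstractSimplicialComplex W} {K : AbstractSimplicialComplex V} (φ : SimplicialMap L K)
    (s : FacePoset L) : FacePoset K :=
  ⟨s.simplex.image φ.toFun, φ.image_mem s.simplex s.mem⟩

end PosetCov

open PosetCov

namespace PosetCov

open Topology Function

/-! ### A criterion for coverings -/

/-! Everything passes through a combinatorial notion, `IsCombCovering`: a simplicial map onto the
vertices of `K`, injective on simplices, along which every simplex through the image of a vertex `w`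
lifts uniquely to a simplex through `w`.

For simplicial maps this is the same as `|φ|` being a covering: open stars are evenly covered by
open stars, and conversely openness and local injectivity of `|φ|` near a vertex give existence and
uniqueness of lifts (`isCombCovering_of_isCovering`). A closed simplex is simply connected, so a
covering of `|K|` has a section over it through any prescribed point. The vertex sets of these
sections form a complex whose realization is the total space (`exists_sectionMap_homeomorph`). Maps
over `|K|` are determined on vertices, so coverings of `|K|` up to equivalence are combinatorial
coverings up to `IsoOver` (`mk_realization_eq_iff`).

For A-spaces a covering is a surjective monotone map with unique lifting of the order both downwards
and upwards (`isCovering_of_lifts`). Such a `p` lifts chains uniquely, so `K(p)` is a combinatorial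
covering; conversely the order of `B` lifts to the vertices of a combinatorial covering of `K(B)`,
whose order complex is the given complex. For face posets, passing to faces is lifting downwards and
lifting simplices is lifting upwards; a covering of the face poset is recovered from the sets of
points over vertices that lie below its elements (`exists_minimalMap_homeomorph`). -/

theorem CoveringClass.mk_eq_mk_iff {B : Type u} [TopologicalSpace B] {E E' : Type v}
    [TopologicalSpace E] [TopologicalSpace E'] {p : E → B} {p' : E' → B} (hp : IsCovering p)
    (hp' : IsCovering p') :
    CoveringClass.mk p hp = CoveringClass.mk p' hp' ↔ ∃ h : E ≃ₜ E', ∀ e, p' (h e) = p e :=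
  Quotient.eq

/-- A continuous open surjection is a covering if every point of the base has an open neighbourhood
whose preimage is covered by disjoint open sheets, each mapped bijectively onto a set containing the
neighbourhood. -/
theorem isCovering_of_sheets {E : Type v} {B : Type u} [TopologicalSpace E] [TopologicalSpace B]
    {p : E → B} (hc : Continuous p) (ho : IsOpenMap p) (hs : Surjective p)
    (h : ∀ b, ∃ V : Set B, IsOpen V ∧ b ∈ V ∧ ∃ (ι : Type v) (U : ι → Set E),
      (∀ i, IsOpen (U i)) ∧ (∀ i, (U i).InjOn p) ∧ (∀ i, (U i).SurjOn p V) ∧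
      Pairwise (Disjoint on U) ∧ p ⁻¹' V ⊆ ⋃ i, U i) :
    IsCovering p := by
  refine ⟨fun b => ?_, hs⟩
  obtain ⟨V, hV, hb, ι, U, hU, inj, surj, disj, exh⟩ := h b
  obtain ⟨e, rfl⟩ := hs b
  obtain ⟨i, -⟩ := Set.mem_iUnion.1 (exh hb)
  have : Nonempty ι := ⟨i⟩
  have : Nonempty (B → E) := ⟨fun _ => e⟩
  let _ : TopologicalSpace ι := ⊥
  have : DiscreteTopology ι := ⟨rfl⟩
  -- `IsCoveringMap` indexes the sheets by the fibre, so the index type `ι` is exchanged for it.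
  refine IsEvenlyCovered.to_isEvenlyCovered_preimage (I := ι) (.of_trivialization
    (t := hV.trivializationDiscrete U V (fun i W hW => ⟨fun h => ?_, fun h => ?_⟩) inj surj disj
      exh) hb)
  · exact (h.preimage hc).inter (hU i)
  · convert ho _ h
    ext w
    constructor
    · intro hw
      obtain ⟨x, hx, rfl⟩ := surj i (hW hw)
      exact ⟨x, ⟨hw, hx⟩, rfl⟩
    · rintro ⟨x, hx, rfl⟩
      exact hx.1

/-! ### Coverings of A-spaces -/

theorem continuous_of_specializes {X Y : Type*} [TopologicalSpace X] [TopologicalSpace Y]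
    [AlexandrovDiscrete X] {f : X → Y} (h : ∀ x y, x ⤳ y → f x ⤳ f y) : Continuous f := by
  refine continuous_def.2 fun U hU => isOpen_iff_forall_specializes.2 fun x y hxy hy => ?_
  exact (h x y hxy).mem_open hU hy

section Alexandrov

variable {E : Type v} {B : Type u} [TopologicalSpace E] [TopologicalSpace B] {p : E → B}

theorem IsCovering.continuous (hp : IsCovering p) : Continuous p := hp.1.continuous

theorem IsCovering.exists_injOn (hp : IsCovering p) (e : E) :
    ∃ U : Set E, IsOpen U ∧ e ∈ U ∧ U.InjOn p := by
  obtain ⟨f, hf, rfl⟩ := hp.1.isLocalHomeomorph e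
  exact ⟨f.source, f.open_source, hf, f.injOn⟩

/-- If `p` is injective on the open set `U` containing `e`, the part of `U` over the minimal
neighbourhood of `p e` lies in every open set containing `e`, because `p` is open. It is thus a
minimal neighbourhood of `e`. -/
theorem IsCovering.alexandrovDiscrete [AlexandrovDiscrete B] (hp : IsCovering p) :
    AlexandrovDiscrete E := by
  refine ⟨fun S hS => isOpen_iff_mem_nhds.2 fun e he => ?_⟩
  obtain ⟨U, hU, heU, inj⟩ := hp.exists_injOn e
  have hN : IsOpen (U ∩ p ⁻¹' nhdsKer {p e}) := hU.inter (isOpen_nhdsKer.preimage hp.continuous)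
  refine Filter.mem_of_superset (hN.mem_nhds ⟨heU, subset_nhdsKer rfl⟩) ?_
  rintro x ⟨hxU, hx⟩ s hs
  have ho : IsOpen (p '' (U ∩ s)) := hp.1.isOpenMap _ (hU.inter (hS s hs))
  have : nhdsKer {p e} ⊆ p '' (U ∩ s) :=
    nhdsKer_minimal (Set.singleton_subset_iff.2 ⟨e, ⟨heU, he s hs⟩, rfl⟩) ho
  obtain ⟨y, hy, hyx⟩ := this hx
  rw [← inj hy.1 hxU hyx]
  exact hy.2

theorem IsCovering.t0Space [T0Space B] (hp : IsCovering p) : T0Space E := by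
  refine ⟨fun e e' h => ?_⟩
  obtain ⟨U, hU, heU, inj⟩ := hp.exists_injOn e
  exact inj heU ((h.mem_open_iff hU).1 heU) (h.map hp.continuous).eq

/-- `p` is open, so the image of the minimal neighbourhood of `e` contains everything below `p e`.
-/
theorem IsCovering.exists_lift_below [AlexandrovDiscrete B] (hp : IsCovering p) {e : E} {b : B}
    (hb : b ⤳ p e) : ∃ e', e' ⤳ e ∧ p e' = b := by
  have := hp.alexandrovDiscrete
  have ho : IsOpen (p '' nhdsKer {e}) := hp.1.isOpenMap _ isOpen_nhdsKer
  obtain ⟨e', he', rfl⟩ := hb.mem_open ho ⟨e, subset_nhdsKer rfl, rfl⟩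
  exact ⟨e', by simpa using he', rfl⟩

/-- Points below `e` lie in every neighbourhood of `e`, in particular in one on which `p` is
injective. -/
theorem IsCovering.eq_of_below (hp : IsCovering p) {e x y : E} (hx : x ⤳ e) (hy : y ⤳ e)
    (hxy : p x = p y) : x = y := by
  obtain ⟨U, hU, heU, inj⟩ := hp.exists_injOn e
  exact inj (hx.mem_open hU heU) (hy.mem_open hU heU) hxy

/-- Openness does not suffice upwards. An evenly covered neighbourhood of `b` contains `p e`, and
the lift is the point over `b` in the sheet of `e`. -/
theorem IsCovering.exists_lift_above (hp : IsCovering p) {e : E} {b : B}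
    (hb : p e ⤳ b) : ∃ e', e ⤳ e' ∧ p e' = b := by
  obtain ⟨-, V, hbV, hV, -, H, hH⟩ := hp.1 b
  have he : p e ∈ V := hb.mem_open hV hbV
  let x : p ⁻¹' V := ⟨e, he⟩
  let y : p ⁻¹' V := H.symm (⟨b, hbV⟩, (H x).2)
  have hxy : H x ⤳ (⟨b, hbV⟩, (H x).2) := by
    refine Specializes.prod (x₁ := (H x).1) (y₁ := (H x).2) ?_ specializes_rfl
    rw [subtype_specializes_iff, hH]
    exact hb
  refine ⟨y, ?_, ?_⟩
  · have := hxy.map H.symm.continuous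
    rw [H.symm_apply_apply] at this
    exact this.map continuous_subtype_val
  · rw [← hH, H.apply_symm_apply]

/-- Distinct points of a fibre have disjoint neighbourhoods, but `e` lies in every neighbourhood of
each. -/
theorem IsCovering.eq_of_above (hp : IsCovering p) {e x y : E} (hx : e ⤳ x) (hy : e ⤳ y)
    (hxy : p x = p y) : x = y := by
  by_contra hne
  obtain ⟨U, V, hU, hV, hxU, hyV, hUV⟩ := hp.1.isSeparatedMap x y hxy hne
  exact Set.disjoint_left.1 hUV (hx.mem_open hU hxU) (hy.mem_open hV hyV)

/-- A map of A-spaces with unique lifting of the order in both directions is a covering. -/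
theorem isCovering_of_lifts [AlexandrovDiscrete E] [AlexandrovDiscrete B]
    (hmono : ∀ x y, x ⤳ y → p x ⤳ p y) (hs : Surjective p)
    (exists_below : ∀ e b, b ⤳ p e → ∃ e', e' ⤳ e ∧ p e' = b)
    (eq_of_below : ∀ e x y, x ⤳ e → y ⤳ e → p x = p y → x = y)
    (exists_above : ∀ e b, p e ⤳ b → ∃ e', e ⤳ e' ∧ p e' = b)
    (eq_of_above : ∀ e x y, e ⤳ x → e ⤳ y → p x = p y → x = y) : IsCovering p := by
  -- The sheets over the minimal neighbourhood of `b` are the minimal neighbourhoods of the points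
  -- over `b`. Lifting downwards makes them bijective onto it; lifting upwards makes them disjoint
  -- and exhaustive.
  refine isCovering_of_sheets (continuous_of_specializes hmono) ?_ hs fun b =>
    ⟨nhdsKer {b}, isOpen_nhdsKer, subset_nhdsKer rfl, p ⁻¹' {b}, fun e => nhdsKer {e.1},
      fun _ => isOpen_nhdsKer, ?_, ?_, ?_, ?_⟩
  · refine fun U hU => isOpen_iff_forall_specializes.2 ?_
    rintro x _ hx ⟨e, he, rfl⟩
    obtain ⟨e', he', rfl⟩ := exists_below e x hx
    exact ⟨e', he'.mem_open hU he, rfl⟩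
  · intro e x hx y hy hxy
    exact eq_of_below e x y (by simpa using hx) (by simpa using hy) hxy
  · rintro ⟨e, rfl⟩ x hx
    obtain ⟨e', he', rfl⟩ := exists_below e x (by simpa using hx)
    exact ⟨e', by simpa using he', rfl⟩
  · rintro ⟨e, he⟩ ⟨e', he'⟩ hne
    refine Set.disjoint_left.2 fun x hx hx' => hne (Subtype.ext ?_)
    exact eq_of_above x e e' (by simpa using hx) (by simpa using hx') (he.trans he'.symm)
  · intro x hx
    obtain ⟨e, he, rfl⟩ := exists_above x b (by simpa using hx)
    exact Set.mem_iUnion.2 ⟨⟨e, rfl⟩, by simpa using he⟩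

end Alexandrov

open scoped Classical

/-! ### Faces of simplicial complexes -/

section Faces

variable {V : Type u} {K : AbstractSimplicialComplex V}

theorem nonempty_of_mem {s : Finset V} (hs : s ∈ K) : s.Nonempty := (K.isRelLowerSet_faces hs).1

theorem mem_of_subset {s t : Finset V} (hs : s ∈ K) (hts : t ⊆ s) (ht : t.Nonempty) : t ∈ K :=
  (K.isRelLowerSet_faces hs).2 hts ht

end Faces

/-! ### Closed simplices -/

section Simplex

variable {V : Type u} {W : Type v}

/-- The standard simplex with vertex set `s`, as a set of functions on the ambient type. -/
def simplexSet (s : Finset V) : Set (V → ℝ) :=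
  {f | (∀ v, 0 ≤ f v) ∧ (∀ v ∉ s, f v = 0) ∧ ∑ v ∈ s, f v = 1}

theorem convex_simplexSet (s : Finset V) : Convex ℝ (simplexSet s) := by
  rintro f ⟨hf0, hfs, hf1⟩ g ⟨hg0, hgs, hg1⟩ a b ha hb hab
  refine ⟨fun v => ?_, fun v hv => ?_, ?_⟩
  · exact add_nonneg (mul_nonneg ha (hf0 v)) (mul_nonneg hb (hg0 v))
  · simp [hfs v hv, hgs v hv]
  · simp [Finset.sum_add_distrib, ← Finset.mul_sum, hf1, hg1, hab]

instance (s : Finset V) : LocallyPathConnectedSpace (simplexSet s) :=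
  (convex_simplexSet s).locallyPathConnectedSpace

theorem simplexSet_mono {s t : Finset V} (h : s ⊆ t) : simplexSet s ⊆ simplexSet t := by
  rintro f ⟨hf0, hfs, hf1⟩
  refine ⟨hf0, fun v hv => hfs v fun hv' => hv (h hv'), ?_⟩
  rw [← hf1]
  exact (Finset.sum_subset h fun v _ hv => hfs v hv).symm

/-- A vertex of the standard simplex. -/
noncomputable def simplexVertex (s : Finset V) (v : V) (hv : v ∈ s) : simplexSet s :=
  ⟨Pi.single v 1, fun w => by
    by_cases h : w = v
    · subst h; simp
    · simp [h], fun w hw => by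
    have : w ≠ v := fun h => hw (h ▸ hv)
    simp [this], by simp [hv]⟩

theorem simplyConnectedSpace_simplexSet {s : Finset V} (hs : s.Nonempty) :
    SimplyConnectedSpace (simplexSet s) := by
  obtain ⟨v, hv⟩ := hs
  have := (convex_simplexSet s).contractibleSpace ⟨_, (simplexVertex s v hv).2⟩
  infer_instance

/-- Interior points of a simplex are dense. -/
theorem exists_interior_point {s : Finset V} (hs : s.Nonempty) (a : simplexSet s)
    {O : Set (simplexSet s)} (hO : O ∈ 𝓝 a) : ∃ b ∈ O, ∀ v ∈ s, 0 < b.1 v := by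
  -- `c` is the barycentre and `γ` the segment from `a` to `c`; all its points except possibly `a`
  -- have positive coordinates on `s`.
  let c : simplexSet s := ⟨fun v => if v ∈ s then (s.card : ℝ)⁻¹ else 0,
    fun v => by positivity, fun v hv => if_neg hv, by
      rw [Finset.sum_congr rfl fun v hv => if_pos hv]
      have : (s.card : ℝ) ≠ 0 := by exact_mod_cast hs.card_pos.ne'
      simp [this]⟩
  let γ : unitInterval → simplexSet s := fun ε =>
    ⟨(1 - ε.1) • a.1 + ε.1 • c.1, convex_simplexSet s a.2 c.2 (by linarith [ε.2.2]) ε.2.1 (by ring)⟩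
  have hγ : Continuous γ := by
    refine Continuous.subtype_mk ?_ _
    fun_prop
  have h0 : γ 0 = a := Subtype.ext (by simp [γ])
  have hmem : γ ⁻¹' O ∈ 𝓝 (0 : unitInterval) := hγ.continuousAt.preimage_mem_nhds (by rwa [h0])
  have hne : (𝓝[>] (0 : unitInterval)).NeBot :=
    nhdsGT_neBot_of_exists_gt ⟨1, zero_lt_one⟩
  obtain ⟨ε, hε, hε0⟩ := hne.nonempty_of_mem
    (Filter.inter_mem (mem_nhdsWithin_of_mem_nhds hmem) self_mem_nhdsWithin)
  refine ⟨γ ε, hε, fun v hv => ?_⟩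
  have hc : 0 < c.1 v := by
    simp only [c, if_pos hv]
    have := hs.card_pos
    positivity
  have hε' : 0 < ε.1 := hε0
  have := a.2.1 v
  have h1 : 0 ≤ 1 - ε.1 := by linarith [ε.2.2]
  exact add_pos_of_nonneg_of_pos (mul_nonneg h1 this) (mul_pos hε' hc)

/-- The map of standard simplices induced by a map of vertices. -/
noncomputable def simplexPush (f : W → V) (t : Finset W) (a : simplexSet t) :
    simplexSet (t.image f) :=
  ⟨fun v => ∑ w ∈ t with f w = v, a.1 w, fun v => Finset.sum_nonneg fun w _ => a.2.1 w,
    fun v hv => by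
      refine Finset.sum_eq_zero fun w hw => ?_
      rw [Finset.mem_filter] at hw
      exact absurd (Finset.mem_image.2 ⟨w, hw⟩) hv,
    by
      rw [Finset.sum_fiberwise_of_maps_to fun w hw => Finset.mem_image_of_mem f hw]
      exact a.2.2.2⟩

theorem continuous_simplexPush (f : W → V) (t : Finset W) : Continuous (simplexPush f t) := by
  refine Continuous.subtype_mk (continuous_pi fun v => continuous_finsetSum _ fun w _ => ?_) _
  exact (continuous_apply w).comp continuous_subtype_val

/-- The inverse of the map of standard simplices induced by a bijection of vertices. -/
noncomputable def simplexPull (f : W → V) {t : Finset W} {s : Finset V}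
    (hf : Set.InjOn f (t : Set W)) (hts : t.image f = s) (a : simplexSet s) : simplexSet t :=
  ⟨fun w => if w ∈ t then a.1 (f w) else 0, fun w => by
      dsimp only
      split_ifs
      exacts [a.2.1 _, le_rfl],
    fun w hw => if_neg hw, by
      subst hts
      rw [Finset.sum_congr rfl fun w hw => if_pos hw, ← a.2.2.2, Finset.sum_image hf]⟩

theorem simplexPull_apply {f : W → V} {t : Finset W} {s : Finset V}
    (hf : Set.InjOn f (t : Set W)) (hts : t.image f = s) (a : simplexSet s) {w : W} (hw : w ∈ t) :
    (simplexPull f hf hts a).1 w = a.1 (f w) :=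
  if_pos hw

theorem continuous_simplexPull (f : W → V) {t : Finset W} {s : Finset V}
    (hf : Set.InjOn f (t : Set W)) (hts : t.image f = s) : Continuous (simplexPull f hf hts) := by
  refine Continuous.subtype_mk (continuous_pi fun w => ?_) _
  split_ifs
  · exact (continuous_apply (f w)).comp continuous_subtype_val
  · exact continuous_const

end Simplex

/-! ### The realization as a union of closed simplices -/

section Realization

variable {V : Type u} {K : AbstractSimplicialComplex V}

theorem coord_mem_simplexSet (x : Realization K) {s : Finset V} (hx : x.coord.support ⊆ s) :
    ⇑x.coord ∈ simplexSet s := by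
  refine ⟨x.nonneg, fun v hv => ?_, ?_⟩
  · by_contra h
    exact hv (hx (Finsupp.mem_support_iff.2 h))
  · rw [← x.sum_eq_one, Finsupp.sum_of_support_subset _ hx _ fun _ _ => rfl]

/-- The characteristic map of a closed simplex. -/
noncomputable def facePoint {s : Finset V} (hs : s ∈ K) (a : simplexSet s) : Realization K :=
  have hsupp : ∀ v, a.1 v ≠ 0 → v ∈ s := fun v hv => by
    by_contra h
    exact hv (a.2.2.1 v h)
  have hsum : ((Finsupp.onFinset s a.1 hsupp).sum fun _ b => b) = 1 := by
    rw [Finsupp.onFinset_sum _ fun _ => rfl]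
    exact a.2.2.2
  { coord := Finsupp.onFinset s a.1 hsupp
    nonneg := a.2.1
    sum_eq_one := hsum
    support_mem := by
      refine mem_of_subset hs Finsupp.support_onFinset_subset ?_
      rw [Finset.nonempty_iff_ne_empty]
      intro h
      rw [Finsupp.support_eq_empty] at h
      rw [h, Finsupp.sum_zero_index] at hsum
      exact zero_ne_one hsum }

@[simp]
theorem facePoint_coord {s : Finset V} (hs : s ∈ K) (a : simplexSet s) (v : V) :
    (facePoint hs a).coord v = a.1 v := rfl

theorem support_facePoint_subset {s : Finset V} (hs : s ∈ K) (a : simplexSet s) :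
    (facePoint hs a).coord.support ⊆ s := fun v hv => by
  by_contra h
  exact Finsupp.mem_support_iff.1 hv (a.2.2.1 v h)

theorem facePoint_coe_coord (x : Realization K) {s : Finset V} (hs : s ∈ K)
    (hx : x.coord.support ⊆ s) : facePoint hs ⟨x.coord, coord_mem_simplexSet x hx⟩ = x := by
  ext v
  rfl

theorem facePoint_injective {s : Finset V} (hs : s ∈ K) : Injective (facePoint hs) := by
  intro a b h
  ext v
  rw [← facePoint_coord hs, h, facePoint_coord]

/-- This turns the weak topology into continuity along characteristic maps, so topological questions
are settled on standard simplices. -/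
theorem isOpen_iff_facePoint {U : Set (Realization K)} :
    IsOpen U ↔ ∀ s (hs : s ∈ K), IsOpen (facePoint hs ⁻¹' U) := by
  rw [realization_isOpen_iff]
  refine forall₂_congr fun s hs => ?_
  rw [isOpen_induced_iff]
  refine exists_congr fun O => and_congr_right fun _ => ?_
  constructor
  · intro h
    ext a
    exact h (facePoint hs a) (support_facePoint_subset hs a)
  · intro h x hx
    have := Set.ext_iff.1 h ⟨x.coord, coord_mem_simplexSet x hx⟩
    rwa [Set.mem_preimage, Set.mem_preimage, facePoint_coe_coord x hs hx] at this

theorem continuous_facePoint {s : Finset V} (hs : s ∈ K) : Continuous (facePoint hs) :=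
  continuous_def.2 fun _ hU => isOpen_iff_facePoint.1 hU s hs

theorem continuous_of_facePoint {Y : Type*} [TopologicalSpace Y] {f : Realization K → Y}
    (h : ∀ s (hs : s ∈ K), Continuous (f ∘ facePoint hs)) : Continuous f :=
  continuous_def.2 fun _ hU => isOpen_iff_facePoint.2 fun s hs => hU.preimage (h s hs)

theorem continuous_coord (v : V) : Continuous fun x : Realization K => x.coord v :=
  continuous_of_facePoint fun _ _ => (continuous_apply v).comp continuous_subtype_val

/-- Open stars serve both as evenly covered sets in the base and as sheets above them. -/
theorem isOpen_star (v : V) : IsOpen {x : Realization K | v ∈ x.coord.support} := by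
  simp only [Finsupp.mem_support_iff]
  exact isOpen_ne_fun (continuous_coord v) continuous_const

/-- A vertex of the complex, as a point of the realization. -/
noncomputable def vertexPoint (K : AbstractSimplicialComplex V) (v : V) : Realization K :=
  facePoint (K.singleton_mem v) (simplexVertex {v} v (Finset.mem_singleton_self v))

theorem facePoint_simplexVertex {s : Finset V} (hs : s ∈ K) (v : V) (hv : v ∈ s) :
    facePoint hs (simplexVertex s v hv) = vertexPoint K v := by
  ext w
  rfl

theorem vertexPoint_coord (v w : V) : (vertexPoint K v).coord w = if w = v then 1 else 0 := by
  change (Pi.single v (1 : ℝ) : V → ℝ) w = _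
  rw [Pi.single_apply]

theorem support_vertexPoint (v : V) : (vertexPoint K v).coord.support = {v} := by
  ext w
  simp [vertexPoint_coord]

theorem vertexPoint_injective : Injective (vertexPoint K) := by
  intro v w h
  have := support_vertexPoint (K := K) v
  rw [h, support_vertexPoint] at this
  exact (Finset.singleton_injective this).symm

theorem eq_vertexPoint {x : Realization K} {v : V} (hx : x.coord.support ⊆ {v}) :
    x = vertexPoint K v := by
  have h := coord_mem_simplexSet x hx
  ext w
  rw [vertexPoint_coord]
  split_ifs with hw
  · subst hw
    simpa using h.2.2
  · exact h.2.1 w (by simpa using hw)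

theorem support_nonempty (x : Realization K) : x.coord.support.Nonempty :=
  nonempty_of_mem x.support_mem

end Realization

/-! ### The realization of a simplicial map -/

section Map

variable {V : Type u} {W : Type v} {K : AbstractSimplicialComplex V}
  {L : AbstractSimplicialComplex W} (φ : SimplicialMap L K)

theorem SimplicialMap.realization_coord (x : Realization L) {t : Finset W}
    (hx : x.coord.support ⊆ t) (v : V) :
    (φ.realization x).coord v = ∑ w ∈ t with φ.toFun w = v, x.coord w := by
  change (x.coord.mapDomain φ.toFun) v = _
  rw [Finsupp.mapDomain, Finsupp.sum_apply, Finsupp.sum_of_support_subset _ hx _ (by simp),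
    Finset.sum_filter]
  simp only [Finsupp.single_apply]

theorem SimplicialMap.support_realization (x : Realization L) :
    (φ.realization x).coord.support = x.coord.support.image φ.toFun := by
  ext v
  rw [Finsupp.mem_support_iff, φ.realization_coord x subset_rfl, ne_eq,
    Finset.sum_eq_zero_iff_of_nonneg fun w _ => x.nonneg w]
  simp only [Finset.mem_filter, Finsupp.mem_support_iff, Finset.mem_image]
  grind

theorem SimplicialMap.realization_coord_of_injOn {x : Realization L} {t : Finset W}
    (hx : x.coord.support ⊆ t) (ht : Set.InjOn φ.toFun (t : Set W)) {w : W} (hw : w ∈ t) :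
    (φ.realization x).coord (φ.toFun w) = x.coord w := by
  rw [φ.realization_coord x hx]
  refine Finset.sum_eq_single_of_mem w (by simp [hw]) fun w' hw' hne => ?_
  rw [Finset.mem_filter] at hw'
  exact absurd (ht hw'.1 hw hw'.2) hne

theorem SimplicialMap.realization_facePoint {t : Finset W} (ht : t ∈ L) (a : simplexSet t) :
    φ.realization (facePoint ht a) = facePoint (φ.image_mem t ht) (simplexPush φ.toFun t a) := by
  ext v
  rw [φ.realization_coord _ (support_facePoint_subset ht a)]
  rfl

theorem SimplicialMap.continuous_realization : Continuous φ.realization := by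
  refine continuous_of_facePoint fun t ht => ?_
  have : φ.realization ∘ facePoint ht
      = facePoint (φ.image_mem t ht) ∘ simplexPush φ.toFun t :=
    funext fun a => φ.realization_facePoint ht a
  rw [this]
  exact (continuous_facePoint _).comp (continuous_simplexPush _ _)

theorem SimplicialMap.eq_of_realization_eq {x y : Realization L} {t : Finset W}
    (hx : x.coord.support ⊆ t) (hy : y.coord.support ⊆ t) (ht : Set.InjOn φ.toFun (t : Set W))
    (hxy : φ.realization x = φ.realization y) : x = y := by
  ext w
  by_cases hw : w ∈ t
  · rw [← φ.realization_coord_of_injOn hx ht hw, hxy, φ.realization_coord_of_injOn hy ht hw]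
  · rw [Finsupp.notMem_support_iff.1 fun h => hw (hx h),
      Finsupp.notMem_support_iff.1 fun h => hw (hy h)]

theorem SimplicialMap.realization_simplexPull {t : Finset W} {s : Finset V} (ht : t ∈ L)
    (hs : s ∈ K) (hinj : Set.InjOn φ.toFun (t : Set W)) (hts : t.image φ.toFun = s)
    (a : simplexSet s) :
    φ.realization (facePoint ht (simplexPull φ.toFun hinj hts a)) = facePoint hs a := by
  ext v
  by_cases hv : v ∈ s
  · obtain ⟨w, hw, rfl⟩ := Finset.mem_image.1 (hts ▸ hv)
    rw [φ.realization_coord_of_injOn (support_facePoint_subset ht _) hinj hw, facePoint_coord,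
      simplexPull_apply hinj hts a hw, facePoint_coord]
  · rw [facePoint_coord, a.2.2.1 v hv, ← Finsupp.notMem_support_iff, φ.support_realization]
    intro h
    rw [← hts] at hv
    exact hv (Finset.image_subset_image (support_facePoint_subset ht _) h)

theorem SimplicialMap.realization_vertexPoint (w : W) :
    φ.realization (vertexPoint L w) = vertexPoint K (φ.toFun w) := by
  refine eq_vertexPoint ?_
  rw [φ.support_realization, support_vertexPoint]
  simp

theorem facePoint_simplexPull_vertex {t : Finset W} {s : Finset V} (ht : t ∈ L)
    (hinj : Set.InjOn φ.toFun (t : Set W)) (hts : t.image φ.toFun = s) {w : W} (hw : w ∈ t)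
    (hws : φ.toFun w ∈ s) :
    facePoint ht (simplexPull φ.toFun hinj hts (simplexVertex s (φ.toFun w) hws))
      = vertexPoint L w := by
  refine φ.eq_of_realization_eq (support_facePoint_subset ht _) ?_ hinj ?_
  · rw [support_vertexPoint]
    simpa using hw
  · rw [φ.realization_simplexPull ht (hts ▸ φ.image_mem t ht), facePoint_simplexVertex,
      φ.realization_vertexPoint]

end Map

/-! ### Combinatorial coverings of simplicial complexes -/

section Combinatorial

variable {V : Type u} {W W' : Type v} {K : AbstractSimplicialComplex V}
  {L : AbstractSimplicialComplex W} {L' : AbstractSimplicialComplex W'}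

/-- A simplicial map that is surjective on vertices, injective on simplices, and has unique lifting
of simplices containing a given vertex. -/
structure IsCombCovering (φ : SimplicialMap L K) : Prop where
  surjective : Surjective φ.toFun
  injOn : ∀ t ∈ L, Set.InjOn φ.toFun (t : Set W)
  exists_lift : ∀ w, ∀ s ∈ K, φ.toFun w ∈ s → ∃ t ∈ L, w ∈ t ∧ t.image φ.toFun = s
  lift_unique : ∀ w, ∀ t ∈ L, ∀ t' ∈ L, w ∈ t → w ∈ t' →
    t.image φ.toFun = t'.image φ.toFun → t = t'

variable {φ : SimplicialMap L K} {φ' : SimplicialMap L' K}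

/-- The vertices of `t` over the image of `r` span a face through `w` with the same image as `r`, so
it is `r` by uniqueness of lifts. -/
theorem IsCombCovering.subset_of_image_subset (hφ : IsCombCovering φ) {r t : Finset W} (hr : r ∈ L)
    (ht : t ∈ L) {w : W} (hwr : w ∈ r) (hwt : w ∈ t)
    (h : r.image φ.toFun ⊆ t.image φ.toFun) : r ⊆ t := by
  let t' := t.filter fun x => φ.toFun x ∈ r.image φ.toFun
  have hwt' : w ∈ t' := Finset.mem_filter.2 ⟨hwt, Finset.mem_image_of_mem _ hwr⟩
  have ht' : t' ∈ L := mem_of_subset ht (Finset.filter_subset _ _) ⟨w, hwt'⟩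
  have : r = t' := by
    refine hφ.lift_unique w r hr t' ht' hwr hwt' ?_
    ext v
    constructor
    · intro hv
      obtain ⟨x, hx, rfl⟩ := Finset.mem_image.1 (h hv)
      exact Finset.mem_image_of_mem _ (Finset.mem_filter.2 ⟨hx, hv⟩)
    · intro hv
      obtain ⟨x, hx, rfl⟩ := Finset.mem_image.1 hv
      exact (Finset.mem_filter.1 hx).2
  rw [this]
  exact Finset.filter_subset _ _

/-- Over a closed simplex `s`, the image of `U` is the union of the traces of `U` on the simplices
`t` mapped isomorphically onto `s`: the carrier of any point over `s` extends to such a `t`. -/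
theorem IsCombCovering.isOpenMap (hφ : IsCombCovering φ) : IsOpenMap φ.realization := by
  intro U hU
  refine isOpen_iff_facePoint.2 fun s hs => ?_
  have : facePoint hs ⁻¹' (φ.realization '' U) = ⋃ (t : Finset W) (ht : t ∈ L)
      (hts : t.image φ.toFun = s),
      (facePoint ht ∘ simplexPull φ.toFun (hφ.injOn t ht) hts) ⁻¹' U := by
    ext a
    simp only [Set.mem_iUnion, Set.mem_preimage, comp_apply]
    constructor
    · rintro ⟨x, hxU, hx⟩
      obtain ⟨w, hw⟩ := support_nonempty x
      have himg : x.coord.support.image φ.toFun ⊆ s := by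
        rw [← φ.support_realization, hx]
        exact support_facePoint_subset hs a
      obtain ⟨t, ht, hwt, hts⟩ := hφ.exists_lift w s hs (himg (Finset.mem_image_of_mem _ hw))
      refine ⟨t, ht, hts, ?_⟩
      have hxt := hφ.subset_of_image_subset x.support_mem ht hw hwt (hts ▸ himg)
      rwa [← φ.eq_of_realization_eq hxt (support_facePoint_subset ht _) (hφ.injOn t ht)
        (hx.trans (φ.realization_simplexPull ht hs (hφ.injOn t ht) hts a).symm)]
    · rintro ⟨t, ht, hts, h⟩
      exact ⟨_, h, φ.realization_simplexPull ht hs _ hts a⟩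
  rw [this]
  exact isOpen_iUnion fun t => isOpen_iUnion fun ht => isOpen_iUnion fun hts =>
    hU.preimage ((continuous_facePoint ht).comp (continuous_simplexPull _ _ _))

theorem IsCombCovering.exists_realization_eq (hφ : IsCombCovering φ) {w : W} {y : Realization K}
    (hw : φ.toFun w ∈ y.coord.support) :
    ∃ x : Realization L, w ∈ x.coord.support ∧ φ.realization x = y := by
  obtain ⟨t, ht, hwt, hts⟩ := hφ.exists_lift w _ y.support_mem hw
  let a : simplexSet y.coord.support := ⟨y.coord, coord_mem_simplexSet y subset_rfl⟩
  have h := φ.realization_simplexPull ht y.support_mem (hφ.injOn t ht) hts a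
  refine ⟨_, ?_, h.trans (facePoint_coe_coord y y.support_mem subset_rfl)⟩
  rw [Finsupp.mem_support_iff, facePoint_coord, simplexPull_apply _ _ _ hwt]
  exact Finsupp.mem_support_iff.1 hw

/-- The open star of `v` is evenly covered by the open stars of the vertices over `v`. -/
theorem IsCombCovering.isCovering (hφ : IsCombCovering φ) : IsCovering φ.realization := by
  refine isCovering_of_sheets φ.continuous_realization hφ.isOpenMap (fun y => ?_) fun y => ?_
  · obtain ⟨v, hv⟩ := support_nonempty y
    obtain ⟨w, rfl⟩ := hφ.surjective v
    obtain ⟨x, -, hx⟩ := hφ.exists_realization_eq hv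
    exact ⟨x, hx⟩
  · obtain ⟨v, hv⟩ := support_nonempty y
    refine ⟨_, isOpen_star v, hv, φ.toFun ⁻¹' {v}, fun w => {x | w.1 ∈ x.coord.support},
      fun w => isOpen_star w.1, ?_, ?_, ?_, ?_⟩
    · intro w x hx x' hx' h
      have hs : x.coord.support = x'.coord.support :=
        hφ.lift_unique w.1 _ x.support_mem _ x'.support_mem hx hx' (by
          rw [← φ.support_realization, ← φ.support_realization, h])
      exact φ.eq_of_realization_eq subset_rfl hs.ge (hφ.injOn _ x.support_mem) h
    · rintro ⟨w, rfl⟩ z hz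
      obtain ⟨x, hx, hxz⟩ := hφ.exists_realization_eq hz
      exact ⟨x, hx, hxz⟩
    · rintro ⟨w, hw⟩ ⟨w', hw'⟩ hne
      refine Set.disjoint_left.2 fun x hx hx' => hne (Subtype.ext ?_)
      exact hφ.injOn _ x.support_mem hx hx' (hw.trans hw'.symm)
    · intro x hx
      rw [Set.mem_preimage, Set.mem_ofPred_eq, φ.support_realization] at hx
      obtain ⟨w, hw, hwv⟩ := Finset.mem_image.1 hx
      exact Set.mem_iUnion.2 ⟨⟨w, hwv⟩, hw⟩

theorem facePoint_interior_support {s : Finset V} (hs : s ∈ K) {a : simplexSet s}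
    (ha : ∀ v ∈ s, 0 < a.1 v) : (facePoint hs a).coord.support = s :=
  (support_facePoint_subset hs a).antisymm fun v hv =>
    Finsupp.mem_support_iff.2 (ha v hv).ne'

/-- A collapsed edge would contain interior points arbitrarily near its end `w` with the same image
as `w`, against local injectivity. -/
theorem injOn_of_isCovering (hφ : IsCovering φ.realization) {t : Finset W} (ht : t ∈ L) :
    Set.InjOn φ.toFun (t : Set W) := by
  intro w hw w' hw' hww'
  by_contra hne
  obtain ⟨N, hN, hwN, inj⟩ := hφ.exists_injOn (vertexPoint L w)
  have hr : ({w, w'} : Finset W) ∈ L := mem_of_subset ht (by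
    intro x hx
    simp only [Finset.mem_insert, Finset.mem_singleton] at hx
    rcases hx with rfl | rfl <;> assumption) (by simp)
  have hv := facePoint_simplexVertex hr w (by simp)
  obtain ⟨a, haN, ha⟩ := exists_interior_point (by simp) (simplexVertex {w, w'} w (by simp))
    ((continuous_facePoint hr).continuousAt.preimage_mem_nhds (by
      rw [hv]; exact hN.mem_nhds hwN))
  have hsupp := facePoint_interior_support hr ha
  have : facePoint hr a = vertexPoint L w := by
    refine inj haN hwN ?_
    rw [φ.realization_vertexPoint]
    refine eq_vertexPoint ?_
    rw [φ.support_realization, hsupp]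
    simp [hww']
  rw [this, support_vertexPoint] at hsupp
  have : w' ∈ ({w} : Finset W) := hsupp ▸ (by simp)
  exact hne (Finset.mem_singleton.1 this).symm

/-- Existence of lifts: the image of the star of `w` is open, so it contains interior points of `s`
near the vertex, and the carrier of a preimage lies over `s`. Uniqueness: near `w`, points of two
lifts over a common interior point coincide by local injectivity, hence so do their carriers. -/
theorem isCombCovering_of_isCovering (hφ : IsCovering φ.realization) : IsCombCovering φ where
  surjective v := by
    obtain ⟨x, hx⟩ := hφ.2 (vertexPoint K v)
    have := φ.support_realization x
    rw [hx, support_vertexPoint] at this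
    obtain ⟨w, -, hw⟩ := Finset.mem_image.1 (this ▸ Finset.mem_singleton_self v)
    exact ⟨w, hw⟩
  injOn t ht := injOn_of_isCovering hφ ht
  exists_lift w s hs hws := by
    have ho : IsOpen (φ.realization '' {x | w ∈ x.coord.support}) :=
      hφ.1.isOpenMap _ (isOpen_star w)
    have hv := facePoint_simplexVertex hs _ hws
    obtain ⟨a, ⟨x, hx, hxa⟩, ha⟩ := exists_interior_point ⟨_, hws⟩ (simplexVertex s _ hws)
      ((continuous_facePoint hs).continuousAt.preimage_mem_nhds (by
        rw [hv]
        refine ho.mem_nhds ⟨vertexPoint L w, ?_, φ.realization_vertexPoint w⟩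
        simp [vertexPoint_coord]))
    refine ⟨_, x.support_mem, hx, ?_⟩
    rw [← φ.support_realization, hxa, facePoint_interior_support hs ha]
  lift_unique w t ht t' ht' hwt hwt' h := by
    have hs : t.image φ.toFun ∈ K := φ.image_mem t ht
    have hws := Finset.mem_image_of_mem φ.toFun hwt
    obtain ⟨N, hN, hwN, inj⟩ := hφ.exists_injOn (vertexPoint L w)
    have hmem : ∀ r (hr : r ∈ L), w ∈ r → ∀ hrs : r.image φ.toFun = t.image φ.toFun,
        (facePoint hr ∘ simplexPull φ.toFun (injOn_of_isCovering hφ hr) hrs) ⁻¹' N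
          ∈ 𝓝 (simplexVertex _ _ hws) := fun r hr hwr hrs => by
      refine ((continuous_facePoint hr).comp
        (continuous_simplexPull _ _ _)).continuousAt.preimage_mem_nhds ?_
      rw [comp_apply, facePoint_simplexPull_vertex φ hr _ hrs hwr]
      exact hN.mem_nhds hwN
    obtain ⟨a, ⟨ha1, ha2⟩, ha⟩ := exists_interior_point ⟨_, hws⟩ (simplexVertex _ _ hws)
      (Filter.inter_mem (hmem t ht hwt rfl) (hmem t' ht' hwt' h.symm))
    have heq := inj ha1 ha2 (by
      simp only [comp_apply]
      rw [φ.realization_simplexPull ht hs, φ.realization_simplexPull ht' hs])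
    have hsupp : ∀ r (hr : r ∈ L), ∀ hrs : r.image φ.toFun = t.image φ.toFun,
        (facePoint hr (simplexPull φ.toFun (injOn_of_isCovering hφ hr) hrs a)).coord.support = r :=
      fun r hr hrs => facePoint_interior_support hr fun x hx => by
        rw [simplexPull_apply _ _ _ hx]
        exact ha _ (hrs ▸ Finset.mem_image_of_mem _ hx)
    rw [← hsupp t ht rfl, ← hsupp t' ht' h.symm]
    exact congrArg (fun x : Realization L => x.coord.support) heq

/-! ### Isomorphisms of simplicial coverings -/

/-- Two simplicial maps to `K` are isomorphic over `K`. -/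
def IsoOver (φ : SimplicialMap L K) (φ' : SimplicialMap L' K) : Prop :=
  ∃ g : W ≃ W', (∀ w, φ'.toFun (g w) = φ.toFun w) ∧ (∀ t ∈ L, t.image g ∈ L') ∧
    ∀ t ∈ L', t.image g.symm ∈ L

theorem realization_homeomorph_of_isoOver (h : IsoOver φ φ') :
    ∃ k : Realization L ≃ₜ Realization L', ∀ x, φ'.realization (k x) = φ.realization x := by
  obtain ⟨g, hg, hgL, hgL'⟩ := h
  let ψ : SimplicialMap L L' := ⟨g, hgL⟩
  let ψ' : SimplicialMap L' L := ⟨g.symm, hgL'⟩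
  refine ⟨⟨⟨ψ.realization, ψ'.realization, fun x => ?_, fun x => ?_⟩, ψ.continuous_realization,
    ψ'.continuous_realization⟩, fun x => ?_⟩
  · refine Realization.ext ?_
    change (x.coord.mapDomain g).mapDomain g.symm = x.coord
    rw [← Finsupp.mapDomain_comp, Equiv.symm_comp_self, Finsupp.mapDomain_id]
  · refine Realization.ext ?_
    change (x.coord.mapDomain g.symm).mapDomain g = x.coord
    rw [← Finsupp.mapDomain_comp, Equiv.self_comp_symm, Finsupp.mapDomain_id]
  · refine Realization.ext ?_
    change (x.coord.mapDomain g).mapDomain φ'.toFun = x.coord.mapDomain φ.toFun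
    rw [← Finsupp.mapDomain_comp]
    congr 1
    exact funext hg

theorem IsCombCovering.eq_singleton (hφ : IsCombCovering φ) {t : Finset W} (ht : t ∈ L) {v : V}
    (h : t.image φ.toFun = {v}) : ∃ w, t = {w} ∧ φ.toFun w = v := by
  have hcard : t.card = 1 := by
    rw [← Finset.card_image_of_injOn (hφ.injOn t ht), h, Finset.card_singleton]
  obtain ⟨w, rfl⟩ := Finset.card_eq_one.1 hcard
  exact ⟨w, rfl, by simpa using h⟩

/-- A continuous map over `|K|` between realizations of combinatorial coverings is simplicial. -/
theorem IsCombCovering.exists_vertexMap (hφ : IsCombCovering φ) (hφ' : IsCombCovering φ')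
    {k : Realization L → Realization L'} (hk : Continuous k)
    (hkφ : ∀ x, φ'.realization (k x) = φ.realization x) :
    ∃ g : W → W', (∀ w, k (vertexPoint L w) = vertexPoint L' (g w)) ∧
      (∀ w, φ'.toFun (g w) = φ.toFun w) ∧ ∀ t ∈ L, t.image g ∈ L' := by
  have hvert : ∀ w, ∃ w', k (vertexPoint L w) = vertexPoint L' w' ∧
      φ'.toFun w' = φ.toFun w := fun w => by
    obtain ⟨w', hw', h⟩ := hφ'.eq_singleton (k (vertexPoint L w)).support_mem (v := φ.toFun w) (by
      rw [← φ'.support_realization, hkφ, φ.realization_vertexPoint, support_vertexPoint])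
    exact ⟨w', eq_vertexPoint hw'.le, h⟩
  choose g hg hgφ using hvert
  refine ⟨g, hg, hgφ, fun t ht => ?_⟩
  obtain ⟨w, hw⟩ := nonempty_of_mem ht
  have hs := φ.image_mem t ht
  have hws := Finset.mem_image_of_mem φ.toFun hw
  -- `k` carries the section given by `t` to one that agrees with the section given by `t'` at the
  -- vertex under `w`. The simplex is connected, so they agree everywhere, and at the other vertices
  -- this puts `g z` in `t'`.
  obtain ⟨t', ht', hwt', hts'⟩ := hφ'.exists_lift (g w) _ hs (hgφ w ▸ hws)
  have := simplyConnectedSpace_simplexSet ⟨_, hws⟩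
  have heq := hφ'.isCovering.1.eq_of_comp_eq
    (g₁ := k ∘ facePoint ht ∘ simplexPull φ.toFun (hφ.injOn t ht) rfl)
    (g₂ := facePoint ht' ∘ simplexPull φ'.toFun (hφ'.injOn t' ht') hts')
    (hk.comp ((continuous_facePoint ht).comp (continuous_simplexPull _ _ _)))
    ((continuous_facePoint ht').comp (continuous_simplexPull _ _ _))
    (by
      funext a
      simp only [comp_apply]
      rw [hkφ, φ.realization_simplexPull ht hs, φ'.realization_simplexPull ht' hs])
    (simplexVertex _ _ hws) (by
      simp only [comp_apply]
      rw [facePoint_simplexPull_vertex φ ht _ _ hw, hg]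
      simp only [← hgφ w]
      rw [facePoint_simplexPull_vertex φ' ht' _ _ hwt'])
  refine mem_of_subset ht' (fun x hx => ?_) ⟨_, Finset.mem_image_of_mem g hw⟩
  obtain ⟨z, hz, rfl⟩ := Finset.mem_image.1 hx
  have hz' := congrFun heq (simplexVertex _ _ (Finset.mem_image_of_mem φ.toFun hz))
  simp only [comp_apply] at hz'
  rw [facePoint_simplexPull_vertex φ ht _ _ hz, hg] at hz'
  have hsub := support_facePoint_subset ht' (simplexPull φ'.toFun (hφ'.injOn t' ht') hts'
    (simplexVertex _ _ (Finset.mem_image_of_mem φ.toFun hz)))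
  rw [← hz', support_vertexPoint] at hsub
  exact hsub (Finset.mem_singleton_self _)

theorem isoOver_of_realization_homeomorph (hφ : IsCombCovering φ) (hφ' : IsCombCovering φ')
    (k : Realization L ≃ₜ Realization L') (hk : ∀ x, φ'.realization (k x) = φ.realization x) :
    IsoOver φ φ' := by
  obtain ⟨g, hg, hgφ, hgL⟩ := hφ.exists_vertexMap hφ' k.continuous hk
  obtain ⟨g', hg', -, hgL'⟩ := hφ'.exists_vertexMap hφ k.symm.continuous fun x => by
    rw [← hk, k.apply_symm_apply]
  refine ⟨⟨g, g', fun w => vertexPoint_injective (K := L) ?_,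
    fun w => vertexPoint_injective (K := L') ?_⟩, hgφ, hgL, hgL'⟩
  · rw [← hg', ← hg, k.symm_apply_apply]
  · rw [← hg, ← hg', k.apply_symm_apply]

theorem mk_realization_eq_iff (hφ : IsCovering φ.realization) (hφ' : IsCovering φ'.realization) :
    CoveringClass.mk φ.realization hφ = CoveringClass.mk φ'.realization hφ' ↔ IsoOver φ φ' := by
  rw [CoveringClass.mk_eq_mk_iff]
  constructor
  · rintro ⟨k, hk⟩
    exact isoOver_of_realization_homeomorph (isCombCovering_of_isCovering hφ)
      (isCombCovering_of_isCovering hφ') k hk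
  · exact realization_homeomorph_of_isoOver

end Combinatorial

/-! ### Coverings of a realization are simplicial -/

section Sections

variable {V : Type u} {E : Type v} {K : AbstractSimplicialComplex V}

/-- The points of the total space that lie over vertices. -/
@[ext]
structure VertexLift (q : E → Realization K) : Type v where
  /-- The underlying point. -/
  val : E
  exists_vertex : ∃ v, q val = vertexPoint K v

/-- The vertex below a point of the total space. -/
noncomputable def VertexLift.label {q : E → Realization K} (w : VertexLift q) : V := w.exists_vertex.choose

theorem VertexLift.map_val {q : E → Realization K} (w : VertexLift q) :
    q w.val = vertexPoint K w.label := w.exists_vertex.choose_spec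

theorem VertexLift.label_eq {q : E → Realization K} (w : VertexLift q) {v : V}
    (h : q w.val = vertexPoint K v) : w.label = v :=
  vertexPoint_injective (w.map_val.symm.trans h)

variable [TopologicalSpace E]

/-- `t` is the set of vertices of a section `F` of `q` over the closed simplex `s`. -/
structure IsSectionOver (q : E → Realization K) {s : Finset V} (hs : s ∈ K)
    (F : C(simplexSet s, E)) (t : Finset (VertexLift q)) : Prop where
  map_eq : ∀ a, q (F a) = facePoint hs a
  mem_iff : ∀ w : VertexLift q, w ∈ t ↔ ∃ h : w.label ∈ s, F (simplexVertex s w.label h) = w.val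

variable {q : E → Realization K}

theorem IsSectionOver.exists_mem {s : Finset V} {hs : s ∈ K} {F : C(simplexSet s, E)}
    {t : Finset (VertexLift q)} (h : IsSectionOver q hs F t) {v : V} (hv : v ∈ s) :
    ∃ w ∈ t, w.label = v := by
  have hq : q (F (simplexVertex s v hv)) = vertexPoint K v := by
    rw [h.map_eq, facePoint_simplexVertex]
  let w : VertexLift q := ⟨F (simplexVertex s v hv), v, hq⟩
  have hw : w.label = v := w.label_eq hq
  exact ⟨w, (h.mem_iff w).2 ⟨hw.symm ▸ hv, by simp only [hw]; rfl⟩, hw⟩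

theorem IsSectionOver.image_label {s : Finset V} {hs : s ∈ K} {F : C(simplexSet s, E)}
    {t : Finset (VertexLift q)} (h : IsSectionOver q hs F t) : t.image VertexLift.label = s := by
  ext v
  rw [Finset.mem_image]
  constructor
  · rintro ⟨w, hw, rfl⟩
    exact ((h.mem_iff w).1 hw).1
  · exact fun hv => h.exists_mem hv

theorem IsSectionOver.injOn {s : Finset V} {hs : s ∈ K} {F : C(simplexSet s, E)}
    {t : Finset (VertexLift q)} (h : IsSectionOver q hs F t) :
    Set.InjOn VertexLift.label (t : Set (VertexLift q)) := by
  intro w hw w' hw' hww'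
  obtain ⟨h1, h2⟩ := (h.mem_iff w).1 hw
  obtain ⟨h1', h2'⟩ := (h.mem_iff w').1 hw'
  refine VertexLift.ext ?_
  rw [← h2, ← h2']
  simp only [hww']

theorem exists_isSectionOver {s : Finset V} {hs : s ∈ K} {F : C(simplexSet s, E)}
    (hF : ∀ a, q (F a) = facePoint hs a) : ∃ t, IsSectionOver q hs F t := by
  have hq : ∀ v (hv : v ∈ s), q (F (simplexVertex s v hv)) = vertexPoint K v := fun v hv => by
    rw [hF, facePoint_simplexVertex]
  refine ⟨s.attach.image fun v => ⟨F (simplexVertex s v.1 v.2), v.1, hq _ _⟩, hF, fun w => ?_⟩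
  rw [Finset.mem_image]
  constructor
  · rintro ⟨v, -, rfl⟩
    have hw := VertexLift.label_eq (q := q) ⟨F (simplexVertex s v.1 v.2), v.1, hq _ _⟩ (hq _ _)
    exact ⟨hw.symm ▸ v.2, by simp only [hw]⟩
  · rintro ⟨h, hw⟩
    exact ⟨⟨_, h⟩, Finset.mem_attach _ _, VertexLift.ext hw⟩

/-- A closed simplex is simply connected and locally path connected, so its characteristic map lifts
through any point. -/
theorem exists_section (hq : IsCovering q) {s : Finset V} (hs : s ∈ K) (a : simplexSet s) (e : E)
    (he : q e = facePoint hs a) :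
    ∃ F : C(simplexSet s, E), F a = e ∧ ∀ b, q (F b) = facePoint hs b := by
  have := simplyConnectedSpace_simplexSet (nonempty_of_mem hs)
  obtain ⟨F, ⟨h1, h2⟩, -⟩ := hq.1.existsUnique_continuousMap_lifts
    ⟨facePoint hs, continuous_facePoint hs⟩ a e he
  exact ⟨F, h1, congrFun h2⟩

theorem section_unique (hq : IsCovering q) {s : Finset V} {hs : s ∈ K} {F F' : C(simplexSet s, E)}
    (hF : ∀ a, q (F a) = facePoint hs a) (hF' : ∀ a, q (F' a) = facePoint hs a) (a : simplexSet s)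
    (ha : F a = F' a) : F = F' := by
  have := simplyConnectedSpace_simplexSet (nonempty_of_mem hs)
  exact DFunLike.coe_injective (hq.1.eq_of_comp_eq F.continuous F'.continuous
    (funext fun b => (hF b).trans (hF' b).symm) a ha)

/-- The restriction of a section to a face. -/
def restrictSection {r s : Finset V} (h : r ⊆ s) (F : C(simplexSet s, E)) : C(simplexSet r, E) :=
  F.comp ⟨Set.inclusion (simplexSet_mono h), continuous_inclusion _⟩

theorem restrictSection_vertex {r s : Finset V} (h : r ⊆ s) (F : C(simplexSet s, E)) {v : V}
    (hv : v ∈ r) :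
    restrictSection h F (simplexVertex r v hv) = F (simplexVertex s v (h hv)) := rfl

theorem restrictSection_map_eq {r s : Finset V} (h : r ⊆ s) {F : C(simplexSet s, E)} {hs : s ∈ K}
    (hr : r ∈ K) (hF : ∀ a, q (F a) = facePoint hs a) (a : simplexSet r) :
    q (restrictSection h F a) = facePoint hr a := by
  refine (hF _).trans ?_
  ext v
  rfl

/-- The complex whose simplices are the sections of `q` over closed simplices of `K`. -/
def sectionComplex (q : E → Realization K) : AbstractSimplicialComplex (VertexLift q) where
  faces := {t | ∃ (s : Finset V) (hs : s ∈ K) (F : C(simplexSet s, E)), IsSectionOver q hs F t}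
  isRelLowerSet_faces := by
    rintro t ⟨s, hs, F, hF⟩
    refine ⟨?_, fun r hrt hr => ?_⟩
    · obtain ⟨v, hv⟩ := nonempty_of_mem hs
      obtain ⟨w, hw, -⟩ := hF.exists_mem hv
      exact ⟨w, hw⟩
    -- A face `r` of `t` is the vertex set of the section restricted to the face of `s` under `r`.
    · have hsub : r.image VertexLift.label ⊆ s :=
        hF.image_label ▸ Finset.image_subset_image hrt
      have hr' : r.image VertexLift.label ∈ K := mem_of_subset hs hsub (hr.image _)
      refine ⟨_, hr', restrictSection hsub F, restrictSection_map_eq hsub hr' hF.map_eq,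
        fun w => ?_⟩
      simp only [restrictSection_vertex]
      constructor
      · exact fun hw => ⟨Finset.mem_image_of_mem _ hw, ((hF.mem_iff w).1 (hrt hw)).2⟩
      · rintro ⟨h, hw⟩
        obtain ⟨w', hw', hww'⟩ := Finset.mem_image.1 h
        rwa [← hF.injOn (hrt hw') ((hF.mem_iff w).2 ⟨hsub h, hw⟩) hww']
  singleton_mem w := by
    refine ⟨{w.label}, K.singleton_mem _, ContinuousMap.const _ w.val, fun a => ?_, fun w' => ?_⟩
    · rw [ContinuousMap.const_apply, w.map_val]
      exact (eq_vertexPoint (support_facePoint_subset _ a)).symm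
    · simp only [ContinuousMap.const_apply, Finset.mem_singleton]
      constructor
      · rintro rfl
        exact ⟨rfl, rfl⟩
      · rintro ⟨-, h⟩
        exact VertexLift.ext h.symm

/-- The projection of the section complex. -/
noncomputable def sectionMap (q : E → Realization K) : SimplicialMap (sectionComplex q) K where
  toFun := VertexLift.label
  image_mem := by
    rintro t ⟨s, hs, F, hF⟩
    rw [hF.image_label]
    exact hs

/-- Lifts of a simplex through `w` are sections through the point `w`, which exist and are unique.
-/
theorem isCombCovering_sectionMap (hq : IsCovering q) : IsCombCovering (sectionMap q) where
  surjective v := by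
    obtain ⟨e, he⟩ := hq.2 (vertexPoint K v)
    exact ⟨⟨e, v, he⟩, VertexLift.label_eq _ he⟩
  injOn := by
    rintro t ⟨s, hs, F, hF⟩
    exact hF.injOn
  exists_lift w s hs hws := by
    obtain ⟨F, hFw, hF⟩ := exists_section hq hs (simplexVertex s w.label hws) w.val
      (w.map_val.trans (facePoint_simplexVertex hs w.label hws).symm)
    obtain ⟨t, ht⟩ := exists_isSectionOver hF
    exact ⟨t, ⟨s, hs, F, ht⟩, (ht.mem_iff w).2 ⟨hws, hFw⟩, ht.image_label⟩
  lift_unique := by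
    rintro w t ⟨s, hs, F, hF⟩ t' ⟨s', hs', F', hF'⟩ hwt hwt' h
    obtain rfl : s = s' := by
      rw [← hF.image_label, ← hF'.image_label]
      exact h
    obtain ⟨h1, h2⟩ := (hF.mem_iff w).1 hwt
    obtain ⟨_, h2'⟩ := (hF'.mem_iff w).1 hwt'
    obtain rfl := section_unique hq hF.map_eq hF'.map_eq _ (h2.trans h2'.symm)
    ext x
    rw [hF.mem_iff, hF'.mem_iff]

theorem support_sectionMap_subset {s : Finset V} {hs : s ∈ K} {F : C(simplexSet s, E)}
    {t : Finset (VertexLift q)} (h : IsSectionOver q hs F t) {x : Realization (sectionComplex q)}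
    (hx : x.coord.support ⊆ t) : ((sectionMap q).realization x).coord.support ⊆ s := by
  rw [SimplicialMap.support_realization]
  exact (Finset.image_subset_image hx).trans h.image_label.le

/-- The value at `x` of a section through the carrier of `x` does not depend on the section. -/
theorem exists_sectionValue (hq : IsCovering q) (x : Realization (sectionComplex q)) :
    ∃ e : E, ∀ (t : Finset (VertexLift q)) (s : Finset V) (hs : s ∈ K) (F : C(simplexSet s, E))
      (h : IsSectionOver q hs F t) (hx : x.coord.support ⊆ t),
      F ⟨_, coord_mem_simplexSet _ (support_sectionMap_subset h hx)⟩ = e := by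
  obtain ⟨r, hr, G, hG⟩ := x.support_mem
  refine ⟨G ⟨_, coord_mem_simplexSet _ (support_sectionMap_subset hG subset_rfl)⟩,
    fun t s hs F hF hx => ?_⟩
  obtain ⟨w, hw⟩ := support_nonempty x
  have hrs : r ⊆ s := by
    rw [← hG.image_label, ← hF.image_label]
    exact Finset.image_subset_image hx
  obtain ⟨h1, h2⟩ := (hG.mem_iff w).1 hw
  obtain ⟨_, h2'⟩ := (hF.mem_iff w).1 (hx hw)
  have : restrictSection hrs F = G := section_unique hq (restrictSection_map_eq hrs hr hF.map_eq)
    hG.map_eq (simplexVertex r w.label h1) (by rw [restrictSection_vertex, h2, h2'])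
  exact DFunLike.congr_fun this
    ⟨_, coord_mem_simplexSet _ (support_sectionMap_subset hG subset_rfl)⟩

/-- A point `x` goes to the value, at its image in `|K|`, of a section through its carrier.
Existence and uniqueness of sections give bijectivity. No continuity of the inverse is checked by
hand: the map is a local homeomorphism because its composite with `q` and `q` itself are. -/
theorem exists_sectionMap_homeomorph (hq : IsCovering q) :
    ∃ k : Realization (sectionComplex q) ≃ₜ E, ∀ x, q (k x) = (sectionMap q).realization x := by
  choose k hk using exists_sectionValue hq
  have hcomb := isCombCovering_sectionMap hq
  have hkq : ∀ x, q (k x) = (sectionMap q).realization x := fun x => by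
    obtain ⟨s, hs, F, hF⟩ := x.support_mem
    rw [← hk x _ s hs F hF subset_rfl, hF.map_eq]
    exact facePoint_coe_coord _ hs (support_sectionMap_subset hF subset_rfl)
  have hcont : Continuous k := by
    refine continuous_of_facePoint fun t ht => ?_
    obtain ⟨s, hs, F, hF⟩ := id ht
    have : k ∘ facePoint ht = fun a => F ⟨_, coord_mem_simplexSet _
        (support_sectionMap_subset hF (support_facePoint_subset ht a))⟩ :=
      funext fun a => (hk _ t s hs F hF (support_facePoint_subset ht a)).symm
    rw [this]
    refine F.continuous.comp (Continuous.subtype_mk (continuous_pi fun v => ?_) _)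
    exact (continuous_coord v).comp
      ((sectionMap q).continuous_realization.comp (continuous_facePoint ht))
  have hinj : Injective k := fun x y hxy => by
    have hφ : (sectionMap q).realization x = (sectionMap q).realization y := by
      rw [← hkq, hxy, hkq]
    obtain ⟨s, hs, F, hF⟩ := x.support_mem
    obtain ⟨s', hs', F', hF'⟩ := y.support_mem
    obtain rfl : s = s' := by
      have := congrArg (fun z : Realization K => z.coord.support) hφ
      simp only [SimplicialMap.support_realization] at this
      rw [← hF.image_label, ← hF'.image_label]
      exact this
    have h1 := hk x _ s hs F hF subset_rfl
    have h2 := hk y _ s hs F' hF' subset_rfl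
    simp only [← hφ] at h2
    have := section_unique hq hF.map_eq hF'.map_eq _ (h1.trans (hxy.trans h2.symm))
    have hsupp : x.coord.support = y.coord.support := by
      ext w
      rw [hF.mem_iff, hF'.mem_iff, this]
    exact (sectionMap q).eq_of_realization_eq subset_rfl hsupp.ge hF.injOn hφ
  have hsurj : Surjective k := fun e => by
    let y := q e
    let a : simplexSet y.coord.support := ⟨y.coord, coord_mem_simplexSet y subset_rfl⟩
    obtain ⟨F, hFe, hF⟩ := exists_section hq y.support_mem a e
      (facePoint_coe_coord y _ subset_rfl).symm
    obtain ⟨t, ht⟩ := exists_isSectionOver hF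
    have htL : t ∈ sectionComplex q := ⟨_, _, F, ht⟩
    refine ⟨facePoint htL (simplexPull (sectionMap q).toFun ht.injOn ht.image_label a), ?_⟩
    rw [← hk _ t _ _ F ht (support_facePoint_subset _ _), ← hFe]
    congr 1
    refine facePoint_injective y.support_mem ?_
    rw [← (sectionMap q).realization_simplexPull htL y.support_mem ht.injOn ht.image_label a]
    exact facePoint_coe_coord _ _
      (support_sectionMap_subset ht (support_facePoint_subset _ _))
  have hloc : IsLocalHomeomorph k := by
    refine IsLocalHomeomorph.of_comp (g := q) ?_ hq.1.isLocalHomeomorph hcont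
    rw [show q ∘ k = (sectionMap q).realization from funext hkq]
    exact hcomb.isCovering.1.isLocalHomeomorph
  exact ⟨(Equiv.ofBijective k ⟨hinj, hsurj⟩).toHomeomorphOfContinuousOpen hcont hloc.isOpenMap, hkq⟩

theorem exists_simplicial_covering (c : CoveringClass.{u, v} (Realization K)) :
    ∃ (W : Type v) (L : AbstractSimplicialComplex W) (φ : SimplicialMap L K)
      (hφ : IsCovering φ.realization), CoveringClass.mk φ.realization hφ = c := by
  induction c using Quotient.ind with
  | _ c =>
    obtain ⟨k, hk⟩ := exists_sectionMap_homeomorph c.isCovering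
    exact ⟨_, _, _, (isCombCovering_sectionMap c.isCovering).isCovering, Quotient.sound ⟨k, hk⟩⟩

end Sections

/-! ### Order complexes -/

section OrderComplex

variable {B : Type u} [TopologicalSpace B]

theorem comparable_of_mem_orderComplex {s : Finset B} (hs : s ∈ orderComplex B) {x y : B}
    (hx : x ∈ s) (hy : y ∈ s) : x ⤳ y ∨ y ⤳ x := by
  by_cases h : x = y
  · exact Or.inl (h ▸ specializes_rfl)
  · exact hs.2 hx hy h

theorem pair_mem_orderComplex {x y : B} (h : x ⤳ y) : ({x, y} : Finset B) ∈ orderComplex B := by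
  refine ⟨by simp, ?_⟩
  rintro a ha b hb hne
  simp only [Finset.coe_insert, Finset.coe_singleton, Set.mem_insert_iff,
    Set.mem_singleton_iff] at ha hb
  rcases ha with rfl | rfl <;> rcases hb with rfl | rfl
  exacts [absurd rfl hne, Or.inl h, Or.inr h, absurd rfl hne]

/-! ### From coverings of an A-space to combinatorial coverings of its order complex -/

section Covering

variable {E : Type v} [TopologicalSpace E] {p : E → B}

theorem IsCovering.eq_of_specializes (hp : IsCovering p) {x y : E} (h : x ⤳ y)
    (hxy : p x = p y) : x = y :=
  hp.eq_of_below h specializes_rfl hxy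

theorem IsCovering.specializes_of_comparable [T0Space B] (hp : IsCovering p) {x y : E}
    (h : x ⤳ y ∨ y ⤳ x) (hxy : p x ⤳ p y) : x ⤳ y := by
  rcases h with h | h
  · exact h
  · rw [hp.eq_of_specializes h ((h.map hp.continuous).antisymm hxy).eq]

theorem IsCovering.eq_of_comparable (hp : IsCovering p) {w x y : E}
    (hx : x ⤳ w ∨ w ⤳ x) (hy : y ⤳ w ∨ w ⤳ y) (hxy : p x = p y) : x = y := by
  have aux : ∀ {x y : E}, x ⤳ w → w ⤳ y → p x = p y → x = y := fun {x y} hx hy hxy =>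
    hp.eq_of_specializes (hx.trans hy) hxy
  rcases hx with hx | hx <;> rcases hy with hy | hy
  exacts [hp.eq_of_below hx hy hxy, aux hx hy hxy, (aux hy hx hxy.symm).symm,
    hp.eq_of_above hx hy hxy]

/-- On the points comparable with `w`, `p` reflects the order. If both lie on the same side of `w`,
the relation in the base is lifted at `y` or at `x`, and uniqueness of lifts identifies the new
point. -/
theorem IsCovering.specializes_of_comparable_of_comparable [AlexandrovDiscrete B] [T0Space B]
    (hp : IsCovering p) {w x y : E} (hx : x ⤳ w ∨ w ⤳ x) (hy : y ⤳ w ∨ w ⤳ y)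
    (hxy : p x ⤳ p y) : x ⤳ y := by
  rcases hx with hx | hx <;> rcases hy with hy | hy
  · obtain ⟨z, hzy, hz⟩ := hp.exists_lift_below hxy
    rwa [hp.eq_of_below hx (hzy.trans hy) hz.symm]
  · exact hx.trans hy
  · exact hp.specializes_of_comparable (Or.inr (hy.trans hx)) hxy
  · obtain ⟨z, hxz, hz⟩ := hp.exists_lift_above hxy
    rwa [hp.eq_of_above hy (hx.trans hxz) hz.symm]

/-- A chain through `p w` is lifted element by element to points comparable with `w`; since `p`
reflects the order there, the lifts form a chain. -/
theorem isCombCovering_orderComplexMap [AlexandrovDiscrete B] [T0Space B] {p : C(E, B)}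
    (hp : IsCovering p) : IsCombCovering (orderComplexMap p) where
  surjective := hp.2
  injOn t ht x hx y hy hxy :=
    hp.eq_of_comparable (w := y) (comparable_of_mem_orderComplex ht hx hy)
      (Or.inl specializes_rfl) hxy
  exists_lift w s hs hws := by
    have hlift : ∀ b : s, ∃ e, (e ⤳ w ∨ w ⤳ e) ∧ p e = b := fun b => by
      rcases comparable_of_mem_orderComplex hs b.2 hws with h | h
      · obtain ⟨e, he, hb⟩ := hp.exists_lift_below h
        exact ⟨e, Or.inl he, hb⟩
      · obtain ⟨e, he, hb⟩ := hp.exists_lift_above h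
        exact ⟨e, Or.inr he, hb⟩
    choose c hcw hc using hlift
    have hw : c ⟨_, hws⟩ = w := hp.eq_of_comparable (hcw _) (Or.inl specializes_rfl) (hc _)
    have hwt : w ∈ Finset.univ.image c := Finset.mem_image.2 ⟨_, Finset.mem_univ _, hw⟩
    refine ⟨Finset.univ.image c, ⟨⟨w, hwt⟩, ?_⟩, hwt, ?_⟩
    · intro x hx y hy _
      obtain ⟨b, -, rfl⟩ := Finset.mem_image.1 (Finset.mem_coe.1 hx)
      obtain ⟨b', -, rfl⟩ := Finset.mem_image.1 (Finset.mem_coe.1 hy)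
      rcases comparable_of_mem_orderComplex hs b.2 b'.2 with h | h
      · exact Or.inl (hp.specializes_of_comparable_of_comparable (hcw b) (hcw b') (by
          rwa [hc, hc]))
      · exact Or.inr (hp.specializes_of_comparable_of_comparable (hcw b') (hcw b) (by
          rwa [hc, hc]))
    · ext b
      simp only [Finset.mem_image, Finset.mem_univ, true_and, exists_exists_eq_and]
      constructor
      · rintro ⟨b, rfl⟩
        exact (congrArg (· ∈ s) (hc b)).mpr b.2
      · exact fun hb => ⟨⟨b, hb⟩, hc _⟩
  lift_unique w t ht t' ht' hwt hwt' h := by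
    have aux : ∀ t ∈ orderComplex E, ∀ t' ∈ orderComplex E, w ∈ t → w ∈ t' →
        t.image p = t'.image p → t ⊆ t' := fun t ht t' ht' hwt hwt' h x hx => by
      obtain ⟨y, hy, hyx⟩ := Finset.mem_image.1 (h ▸ Finset.mem_image_of_mem p hx)
      rwa [← hp.eq_of_comparable (comparable_of_mem_orderComplex ht' hy hwt')
        (comparable_of_mem_orderComplex ht hx hwt) hyx]
    exact (aux t ht t' ht' hwt hwt' h).antisymm (aux t' ht' t ht hwt' hwt h.symm)

theorem IsCovering.orderComplexMap [AlexandrovDiscrete B] [T0Space B] {p : C(E, B)}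
    (hp : IsCovering p) : IsCovering (orderComplexMap p).realization :=
  (isCombCovering_orderComplexMap hp).isCovering

end Covering

/-! ### Equivalence of coverings and isomorphism of order complexes -/

section Iso

variable {E E' : Type v} [TopologicalSpace E] [TopologicalSpace E'] {p : C(E, B)} {p' : C(E', B)}

/-- A simplicial map of order complexes preserves only comparability; the direction is recovered
from the base. -/
theorem specializes_map_of_isoOver [T0Space B] (hp' : IsCovering p') {g : E → E'}
    (hg : ∀ e, p' (g e) = p e) (hgK : ∀ t ∈ orderComplex E, t.image g ∈ orderComplex E') {x y : E}
    (h : x ⤳ y) : g x ⤳ g y := by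
  refine hp'.specializes_of_comparable (comparable_of_mem_orderComplex
    (hgK _ (pair_mem_orderComplex h)) ?_ ?_) ?_
  · simp
  · simp
  · rw [hg, hg]
    exact h.map p.continuous

theorem exists_homeomorph_of_isoOver [AlexandrovDiscrete B] [T0Space B] (hp : IsCovering p)
    (hp' : IsCovering p') (h : IsoOver (orderComplexMap p) (orderComplexMap p')) :
    ∃ k : E ≃ₜ E', ∀ e, p' (k e) = p e := by
  obtain ⟨g, hg, hgK, hgK'⟩ := h
  have := hp.alexandrovDiscrete
  have := hp'.alexandrovDiscrete
  have hg' : ∀ e, p (g.symm e) = p' e := fun e => by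
    have := hg (g.symm e)
    rw [g.apply_symm_apply] at this
    exact this.symm
  exact ⟨⟨g, continuous_of_specializes fun x y h => specializes_map_of_isoOver hp' hg hgK h,
    continuous_of_specializes fun x y h => specializes_map_of_isoOver hp hg' hgK' h⟩, hg⟩

theorem isoOver_orderComplexMap_of_homeomorph (k : E ≃ₜ E') (hk : ∀ e, p' (k e) = p e) :
    IsoOver (orderComplexMap p) (orderComplexMap p') :=
  ⟨k.toEquiv, hk, (orderComplexMap (k : C(E, E'))).image_mem,
    (orderComplexMap (k.symm : C(E', E))).image_mem⟩

end Iso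

/-! ### From combinatorial coverings of the order complex to coverings of the A-space -/

section Reconstruction

variable {W : Type v} {L : AbstractSimplicialComplex W} {φ : SimplicialMap L (orderComplex B)}

/-- The order on the vertices of a complex over an order complex. -/
def LiftedRel (φ : SimplicialMap L (orderComplex B)) (x y : W) : Prop :=
  (∃ t ∈ L, x ∈ t ∧ y ∈ t) ∧ φ.toFun x ⤳ φ.toFun y

/-- The A-space topology defined by the lifted order. -/
@[reducible]
def liftedTopology (φ : SimplicialMap L (orderComplex B)) : TopologicalSpace W where
  IsOpen U := ∀ x y, LiftedRel φ x y → y ∈ U → x ∈ U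
  isOpen_univ _ _ _ _ := trivial
  isOpen_inter _ _ hU hU' x y h hy := ⟨hU x y h hy.1, hU' x y h hy.2⟩
  isOpen_sUnion S hS x y h := by
    rintro ⟨U, hU, hy⟩
    exact ⟨U, hU, hS U hU x y h hy⟩

theorem alexandrovDiscrete_liftedTopology (φ : SimplicialMap L (orderComplex B)) :
    @AlexandrovDiscrete W (liftedTopology φ) := by
  let _ := liftedTopology φ
  exact ⟨fun S hS x y h hy U hU => hS U hU x y h (hy U hU)⟩

/-- Edges lift uniquely: `{x, w}` lies over a face of the image of `t'`, so it is a face of `t'`,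
where `φ` is injective. -/
theorem IsCombCovering.eq_of_mem_of_mem {V : Type u} {K : AbstractSimplicialComplex V}
    {φ : SimplicialMap L K} (hφ : IsCombCovering φ) {w x y : W} (hx : ∃ t ∈ L, x ∈ t ∧ w ∈ t)
    (hy : ∃ t ∈ L, y ∈ t ∧ w ∈ t) (hxy : φ.toFun x = φ.toFun y) : x = y := by
  obtain ⟨t, ht, hxt, hwt⟩ := hx
  obtain ⟨t', ht', hyt', hwt'⟩ := hy
  have hr : ({x, w} : Finset W) ∈ L := mem_of_subset ht (by
    simp [Finset.insert_subset_iff, hxt, hwt]) (by simp)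
  have : ({x, w} : Finset W) ⊆ t' := hφ.subset_of_image_subset hr ht' (w := w) (by simp) hwt' (by
    simp only [Finset.image_insert, Finset.image_singleton, hxy]
    simp [Finset.insert_subset_iff, -Finset.mem_image, Finset.mem_image_of_mem, hyt', hwt'])
  exact hφ.injOn t' ht' (this (by simp)) hyt' hxy

/-- The three images form a chain; its lift through the middle vertex `y` contains `x` and `z` by
unique lifting of edges. -/
theorem LiftedRel.trans (hφ : IsCombCovering φ) {x y z : W} (hxy : LiftedRel φ x y)
    (hyz : LiftedRel φ y z) : LiftedRel φ x z := by
  refine ⟨?_, hxy.2.trans hyz.2⟩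
  have hs : ({φ.toFun x, φ.toFun y, φ.toFun z} : Finset B) ∈ orderComplex B := by
    refine ⟨by simp, ?_⟩
    have hxz := hxy.2.trans hyz.2
    have h1 := hxy.2
    have h2 := hyz.2
    intro a ha b hb hne
    simp only [Finset.coe_insert, Finset.coe_singleton, Set.mem_insert_iff,
      Set.mem_singleton_iff] at ha hb
    rcases ha with rfl | rfl | rfl <;> rcases hb with rfl | rfl | rfl <;> tauto
  obtain ⟨t, ht, hyt, hts⟩ := hφ.exists_lift y _ hs (by simp)
  have hmem : ∀ w, (∃ r ∈ L, w ∈ r ∧ y ∈ r) → φ.toFun w ∈ t.image φ.toFun → w ∈ t :=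
    fun w hw h => by
      obtain ⟨w', hw', h⟩ := Finset.mem_image.1 h
      rwa [← hφ.eq_of_mem_of_mem ⟨t, ht, hw', hyt⟩ hw h]
  obtain ⟨r, hr, hyr, hzr⟩ := hyz.1
  exact ⟨t, ht, hmem x hxy.1 (by simp [hts]), hmem z ⟨r, hr, hzr, hyr⟩ (by simp [hts])⟩

theorem specializes_liftedTopology_iff (hφ : IsCombCovering φ) {x y : W} :
    @Specializes W (liftedTopology φ) x y ↔ LiftedRel φ x y := by
  let _ := liftedTopology φ
  constructor
  · intro h
    have ho : IsOpen {z | LiftedRel φ z y} := fun a b hab hb => hab.trans hφ hb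
    exact h.mem_open ho ⟨⟨{y}, L.singleton_mem y, by simp⟩, specializes_rfl⟩
  · exact fun h => specializes_iff_forall_open.2 fun U hU hy => hU x y h hy

theorem isCovering_liftedTopology [AlexandrovDiscrete B] (hφ : IsCombCovering φ) :
    @IsCovering W B (liftedTopology φ) _ φ.toFun := by
  let _ := liftedTopology φ
  have := alexandrovDiscrete_liftedTopology φ
  have hlift : ∀ e b, ({b, φ.toFun e} : Finset B) ∈ orderComplex B →
      ∃ e', (∃ t ∈ L, e' ∈ t ∧ e ∈ t) ∧ φ.toFun e' = b := fun e b hs => by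
    obtain ⟨t, ht, het, hts⟩ := hφ.exists_lift e _ hs (by simp)
    obtain ⟨e', he', hb⟩ := Finset.mem_image.1 (hts ▸ Finset.mem_insert_self b _)
    exact ⟨e', ⟨t, ht, he', het⟩, hb⟩
  have hsymm : ∀ {x y : W}, (∃ t ∈ L, x ∈ t ∧ y ∈ t) → ∃ t ∈ L, y ∈ t ∧ x ∈ t :=
    fun ⟨t, ht, hx, hy⟩ => ⟨t, ht, hy, hx⟩
  refine isCovering_of_lifts ?_ hφ.surjective ?_ ?_ ?_ ?_ <;>
    simp only [specializes_liftedTopology_iff hφ]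
  · exact fun x y h => h.2
  · intro e b hb
    obtain ⟨e', he', rfl⟩ := hlift e b (pair_mem_orderComplex hb)
    exact ⟨e', ⟨he', hb⟩, rfl⟩
  · exact fun e x y hx hy hxy => hφ.eq_of_mem_of_mem hx.1 hy.1 hxy
  · intro e b hb
    obtain ⟨e', he', rfl⟩ := hlift e b (Finset.pair_comm b _ ▸ pair_mem_orderComplex hb)
    exact ⟨e', ⟨hsymm he', hb⟩, rfl⟩
  · exact fun e x y hx hy hxy => hφ.eq_of_mem_of_mem (hsymm hx.1) (hsymm hy.1) hxy

/-- A chain of the lifted order has a chain as image. The lift of this image through one vertex `w`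
contains every vertex of the chain, each being joined to `w` by an edge. -/
theorem mem_orderComplex_liftedTopology_iff (hφ : IsCombCovering φ) {t : Finset W} :
    t ∈ @orderComplex W (liftedTopology φ) ↔ t ∈ L := by
  let _ := liftedTopology φ
  constructor
  · intro ht
    have hcomp : ∀ x ∈ t, ∀ y ∈ t, LiftedRel φ x y ∨ LiftedRel φ y x := fun x hx y hy => by
      simpa only [specializes_liftedTopology_iff hφ] using comparable_of_mem_orderComplex ht hx hy
    have hs : t.image φ.toFun ∈ orderComplex B := by
      refine ⟨ht.1.image _, ?_⟩
      intro a ha b hb _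
      obtain ⟨x, hx, rfl⟩ := Finset.mem_image.1 (Finset.mem_coe.1 ha)
      obtain ⟨y, hy, rfl⟩ := Finset.mem_image.1 (Finset.mem_coe.1 hb)
      exact (hcomp x hx y hy).imp And.right And.right
    obtain ⟨w, hw⟩ := ht.1
    obtain ⟨r, hr, hwr, hrs⟩ := hφ.exists_lift w _ hs (Finset.mem_image_of_mem _ hw)
    refine mem_of_subset hr (fun x hx => ?_) ht.1
    obtain ⟨y, hy, hyx⟩ := Finset.mem_image.1 (hrs ▸ Finset.mem_image_of_mem φ.toFun hx)
    have hxw : ∃ t ∈ L, x ∈ t ∧ w ∈ t := by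
      rcases hcomp x hx w hw with h | h
      · exact h.1
      · obtain ⟨⟨t', ht', h1, h2⟩, -⟩ := h
        exact ⟨t', ht', h2, h1⟩
    rwa [← hφ.eq_of_mem_of_mem ⟨r, hr, hy, hwr⟩ hxw hyx]
  · intro ht
    refine ⟨nonempty_of_mem ht, fun x hx y hy _ => ?_⟩
    simp only [specializes_liftedTopology_iff hφ]
    exact (comparable_of_mem_orderComplex (φ.image_mem t ht) (Finset.mem_image_of_mem _ hx)
      (Finset.mem_image_of_mem _ hy)).imp (fun h => ⟨⟨t, ht, hx, hy⟩, h⟩)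
      (fun h => ⟨⟨t, ht, hy, hx⟩, h⟩)

end Reconstruction

theorem orderComplex_bijection (B : Type u) [TopologicalSpace B] [AlexandrovDiscrete B]
    [T0Space B] :
    ∃ Φ : CoveringClass.{u, v} B → CoveringClass.{u, v} (Realization (orderComplex B)),
      Bijective Φ ∧ ∀ (E : Type v) [TopologicalSpace E] (p : C(E, B)) (hp : IsCovering p)
        (hKp : IsCovering (orderComplexMap p).realization),
        Φ (CoveringClass.mk p hp) = CoveringClass.mk (orderComplexMap p).realization hKp := by
  let toMap (c : Covering.{u, v} B) : C(c.total, B) := ⟨c.proj, c.isCovering.continuous⟩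
  have hcov (c : Covering.{u, v} B) : IsCovering (toMap c) := c.isCovering
  let Φ : CoveringClass.{u, v} B → CoveringClass.{u, v} (Realization (orderComplex B)) :=
    Quotient.lift
      (fun c => CoveringClass.mk (orderComplexMap (toMap c)).realization (hcov c).orderComplexMap)
      (by
        rintro c c' ⟨k, hk⟩
        exact (mk_realization_eq_iff _ _).2 (isoOver_orderComplexMap_of_homeomorph k hk))
  refine ⟨Φ, ⟨?_, ?_⟩, fun E _ p hp hKp => rfl⟩
  · intro c c'
    induction c using Quotient.ind with | _ c
    induction c' using Quotient.ind with | _ c'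
    intro h
    have hiso := (mk_realization_eq_iff (hcov c).orderComplexMap (hcov c').orderComplexMap).1 h
    exact Quotient.sound (exists_homeomorph_of_isoOver (hcov c) (hcov c') hiso)
  · intro c
    obtain ⟨W, L, φ, hφ, rfl⟩ := exists_simplicial_covering c
    have hcomb := isCombCovering_of_isCovering hφ
    let _ := liftedTopology φ
    have hp := isCovering_liftedTopology hcomb
    -- The order complex of the lifted order has the simplices of `L`, so the identity on vertices
    -- is an isomorphism over the base.
    refine ⟨CoveringClass.mk φ.toFun hp, (mk_realization_eq_iff _ _).2
      ⟨Equiv.refl W, fun _ => rfl, fun t ht => ?_, fun t ht => ?_⟩⟩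
    · simpa using (mem_orderComplex_liftedTopology_iff hcomb).1 ht
    · simpa using (mem_orderComplex_liftedTopology_iff hcomb).2 ht

end OrderComplex

/-! ### Face posets -/

section FacePoset

variable {V : Type u} {K : AbstractSimplicialComplex V}

instance : Topology.IsLowerSet (FacePoset K) := ⟨rfl⟩

theorem FacePoset.specializes_iff {s t : FacePoset K} : s ⤳ t ↔ s.simplex ⊆ t.simplex :=
  Topology.IsLowerSet.specializes_iff_le

/-- A vertex, as an element of the face poset. -/
def FacePoset.vertex (K : AbstractSimplicialComplex V) (v : V) : FacePoset K :=
  ⟨{v}, K.singleton_mem v⟩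

theorem FacePoset.vertex_injective : Injective (FacePoset.vertex K) := fun _ _ h =>
  Finset.singleton_injective (congrArg FacePoset.simplex h)

theorem FacePoset.vertex_specializes_iff {v : V} {s : FacePoset K} :
    FacePoset.vertex K v ⤳ s ↔ v ∈ s.simplex :=
  FacePoset.specializes_iff.trans Finset.singleton_subset_iff

/-! ### Face posets of combinatorial coverings -/

section Map

variable {W W' : Type v} {L : AbstractSimplicialComplex W} {L' : AbstractSimplicialComplex W'}
  {φ : SimplicialMap L K} {φ' : SimplicialMap L' K}

/-- Lifting downwards takes the face over a given subset, unique by injectivity on simplices;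
lifting upwards is lifting a simplex through a vertex. -/
theorem IsCombCovering.isCovering_facePoset (hφ : IsCombCovering φ) : IsCovering φ.facePoset := by
  have hsub : ∀ {r r' t : FacePoset L}, r.simplex ⊆ t.simplex → r'.simplex ⊆ t.simplex →
      r.simplex.image φ.toFun = r'.simplex.image φ.toFun → r.simplex ⊆ r'.simplex := by
    intro r r' t hr hr' h x hx
    obtain ⟨y, hy, hyx⟩ := Finset.mem_image.1 (h ▸ Finset.mem_image_of_mem φ.toFun hx)
    rwa [← hφ.injOn _ t.mem (hr' hy) (hr hx) hyx]
  refine isCovering_of_lifts ?_ ?_ ?_ ?_ ?_ ?_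
  · simp only [FacePoset.specializes_iff]
    exact fun s t h => Finset.image_subset_image h
  · intro s
    obtain ⟨v, hv⟩ := nonempty_of_mem s.mem
    obtain ⟨w, rfl⟩ := hφ.surjective v
    obtain ⟨t, ht, -, hts⟩ := hφ.exists_lift w _ s.mem hv
    exact ⟨⟨t, ht⟩, FacePoset.ext hts⟩
  · simp only [FacePoset.specializes_iff]
    intro t s hst
    obtain ⟨v, hv⟩ := nonempty_of_mem s.mem
    obtain ⟨w, hw, rfl⟩ := Finset.mem_image.1 (hst hv)
    refine ⟨⟨t.simplex.filter fun x => φ.toFun x ∈ s.simplex, mem_of_subset t.mem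
      (Finset.filter_subset _ _) ⟨w, Finset.mem_filter.2 ⟨hw, hv⟩⟩⟩, Finset.filter_subset _ _,
      FacePoset.ext ?_⟩
    ext v
    change v ∈ Finset.image _ _ ↔ _
    constructor
    · intro h
      obtain ⟨x, hx, rfl⟩ := Finset.mem_image.1 h
      exact (Finset.mem_filter.1 hx).2
    · intro h
      obtain ⟨x, hx, rfl⟩ := Finset.mem_image.1 (hst h)
      exact Finset.mem_image_of_mem _ (Finset.mem_filter.2 ⟨hx, h⟩)
  · simp only [FacePoset.specializes_iff]
    intro t r r' hr hr' h
    have h' := congrArg FacePoset.simplex h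
    exact FacePoset.ext ((hsub hr hr' h').antisymm (hsub hr' hr h'.symm))
  · simp only [FacePoset.specializes_iff]
    intro t s hts
    obtain ⟨w, hw⟩ := nonempty_of_mem t.mem
    obtain ⟨t', ht', hwt', h⟩ := hφ.exists_lift w _ s.mem (hts (Finset.mem_image_of_mem _ hw))
    exact ⟨⟨t', ht'⟩, hφ.subset_of_image_subset t.mem ht' hw hwt' (h.symm ▸ hts),
      FacePoset.ext h⟩
  · simp only [FacePoset.specializes_iff]
    intro r t t' hr hr' h
    obtain ⟨w, hw⟩ := nonempty_of_mem r.mem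
    exact FacePoset.ext (hφ.lift_unique w _ t.mem _ t'.mem (hr hw) (hr' hw)
      (congrArg FacePoset.simplex h))

theorem facePoset_homeomorph_of_isoOver (h : IsoOver φ φ') :
    ∃ k : FacePoset L ≃ₜ FacePoset L', ∀ t, φ'.facePoset (k t) = φ.facePoset t := by
  obtain ⟨g, hg, hgL, hgL'⟩ := h
  refine ⟨⟨⟨fun t => ⟨t.simplex.image g, hgL _ t.mem⟩, fun t => ⟨t.simplex.image g.symm,
    hgL' _ t.mem⟩, fun t => ?_, fun t => ?_⟩, ?_, ?_⟩, fun t => ?_⟩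
  · exact FacePoset.ext (by simp [Finset.image_image])
  · exact FacePoset.ext (by simp [Finset.image_image])
  · refine continuous_of_specializes fun s t h => ?_
    rw [FacePoset.specializes_iff] at h ⊢
    exact Finset.image_subset_image h
  · refine continuous_of_specializes fun s t h => ?_
    rw [FacePoset.specializes_iff] at h ⊢
    exact Finset.image_subset_image h
  · refine FacePoset.ext ?_
    change (t.simplex.image g).image φ'.toFun = t.simplex.image φ.toFun
    rw [Finset.image_image]
    exact Finset.image_congr fun w _ => hg w

/-- Over a vertex there are only vertices, as `φ'` is injective on simplices. By monotonicity the
vertices of `t` map into `k t`, so their image is a face of it. -/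
theorem IsCombCovering.exists_vertexMap_of_facePoset (hφ' : IsCombCovering φ')
    {k : FacePoset L → FacePoset L'} (hk : Continuous k)
    (hkφ : ∀ t, φ'.facePoset (k t) = φ.facePoset t) :
    ∃ g : W → W', (∀ w, k (FacePoset.vertex L w) = FacePoset.vertex L' (g w)) ∧
      (∀ w, φ'.toFun (g w) = φ.toFun w) ∧ ∀ t ∈ L, t.image g ∈ L' := by
  have hvert : ∀ w, ∃ w', k (FacePoset.vertex L w) = FacePoset.vertex L' w' ∧
      φ'.toFun w' = φ.toFun w := fun w => by
    obtain ⟨w', hw', h⟩ := hφ'.eq_singleton (k (FacePoset.vertex L w)).mem (v := φ.toFun w)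
      ((congrArg FacePoset.simplex (hkφ (FacePoset.vertex L w))).trans
        (Finset.image_singleton φ.toFun w))
    exact ⟨w', FacePoset.ext hw', h⟩
  choose g hg hgφ using hvert
  refine ⟨g, hg, hgφ, fun t ht => mem_of_subset (k ⟨t, ht⟩).mem (fun x hx => ?_)
    ((nonempty_of_mem ht).image g)⟩
  obtain ⟨w, hw, rfl⟩ := Finset.mem_image.1 hx
  have h : FacePoset.vertex L w ⤳ ⟨t, ht⟩ := FacePoset.vertex_specializes_iff.2 hw
  have := h.map hk
  rwa [hg, FacePoset.vertex_specializes_iff] at this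

theorem mk_facePoset_eq_iff (hφ : IsCombCovering φ) (hφ' : IsCombCovering φ')
    (hXφ : IsCovering φ.facePoset) (hXφ' : IsCovering φ'.facePoset) :
    CoveringClass.mk φ.facePoset hXφ = CoveringClass.mk φ'.facePoset hXφ' ↔ IsoOver φ φ' := by
  rw [CoveringClass.mk_eq_mk_iff]
  refine ⟨?_, facePoset_homeomorph_of_isoOver⟩
  rintro ⟨k, hk⟩
  obtain ⟨g, hg, hgφ, hgL⟩ := hφ'.exists_vertexMap_of_facePoset k.continuous hk
  obtain ⟨g', hg', -, hgL'⟩ := hφ.exists_vertexMap_of_facePoset k.symm.continuous fun x => by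
    rw [← hk, k.apply_symm_apply]
  refine ⟨⟨g, g', fun w => FacePoset.vertex_injective (K := L) ?_,
    fun w => FacePoset.vertex_injective (K := L') ?_⟩, hgφ, hgL, hgL'⟩
  · rw [← hg', ← hg, k.symm_apply_apply]
  · rw [← hg, ← hg', k.apply_symm_apply]

end Map

/-! ### Coverings of face posets are simplicial -/

section Reconstruction

variable {E : Type v} {p : E → FacePoset K}

/-- The points of the total space that lie over vertices. -/
@[ext]
structure MinimalLift (p : E → FacePoset K) : Type v where
  /-- The underlying point. -/
  val : E
  exists_vertex : ∃ v, p val = FacePoset.vertex K v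

/-- The vertex below a point of the total space. -/
noncomputable def MinimalLift.label (w : MinimalLift p) : V := w.exists_vertex.choose

theorem MinimalLift.map_val (w : MinimalLift p) : p w.val = FacePoset.vertex K w.label :=
  w.exists_vertex.choose_spec

theorem MinimalLift.label_eq (w : MinimalLift p) {v : V} (h : p w.val = FacePoset.vertex K v) :
    w.label = v :=
  FacePoset.vertex_injective (w.map_val.symm.trans h)

variable [TopologicalSpace E]

theorem MinimalLift.label_mem (hp : IsCovering p) {w : MinimalLift p} {e : E} (h : w.val ⤳ e) :
    w.label ∈ (p e).simplex := by
  have := h.map hp.continuous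
  rwa [w.map_val, FacePoset.vertex_specializes_iff] at this

theorem MinimalLift.eq_of_below (hp : IsCovering p) {w w' : MinimalLift p} {e : E}
    (h : w.val ⤳ e) (h' : w'.val ⤳ e) (hww' : w.label = w'.label) : w = w' :=
  MinimalLift.ext (hp.eq_of_below h h' (by rw [w.map_val, w'.map_val, hww']))

theorem MinimalLift.exists_below (hp : IsCovering p) {e : E} {v : V} (hv : v ∈ (p e).simplex) :
    ∃ w : MinimalLift p, w.val ⤳ e ∧ w.label = v := by
  obtain ⟨x, hx, hxv⟩ := hp.exists_lift_below (FacePoset.vertex_specializes_iff.2 hv)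
  exact ⟨⟨x, v, hxv⟩, hx, MinimalLift.label_eq _ hxv⟩

/-- The vertex of `e'` with the label of `w` is also below `e`, so it is `w`. -/
theorem MinimalLift.specializes_of_below (hp : IsCovering p) {w : MinimalLift p} {e e' : E}
    (hw : w.val ⤳ e) (he : e' ⤳ e) (hwe : w.label ∈ (p e').simplex) : w.val ⤳ e' := by
  obtain ⟨w', hw', h⟩ := MinimalLift.exists_below hp hwe
  rwa [← MinimalLift.eq_of_below hp (hw'.trans he) hw h]

/-- `t` is the set of vertices of the element `e`. -/
def IsVertexSet (t : Finset (MinimalLift p)) (e : E) : Prop := ∀ w, w ∈ t ↔ w.val ⤳ e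

theorem exists_isVertexSet (hp : IsCovering p) (e : E) :
    ∃ t : Finset (MinimalLift p), IsVertexSet t e := by
  choose f hf hfl using fun v : (p e).simplex => MinimalLift.exists_below hp v.2
  refine ⟨Finset.univ.image f, fun w => ⟨fun h => ?_, fun h => ?_⟩⟩
  · obtain ⟨v, -, rfl⟩ := Finset.mem_image.1 h
    exact hf v
  · exact Finset.mem_image.2 ⟨⟨w.label, MinimalLift.label_mem hp h⟩, Finset.mem_univ _,
      MinimalLift.eq_of_below hp (hf _) h (hfl _)⟩

theorem IsVertexSet.image_label (hp : IsCovering p) {t : Finset (MinimalLift p)} {e : E}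
    (h : IsVertexSet t e) : t.image MinimalLift.label = (p e).simplex := by
  ext v
  rw [Finset.mem_image]
  constructor
  · rintro ⟨w, hw, rfl⟩
    exact MinimalLift.label_mem hp ((h w).1 hw)
  · intro hv
    obtain ⟨w, hw, hwv⟩ := MinimalLift.exists_below hp hv
    exact ⟨w, (h w).2 hw, hwv⟩

theorem IsVertexSet.nonempty (hp : IsCovering p) {t : Finset (MinimalLift p)} {e : E}
    (h : IsVertexSet t e) : t.Nonempty := by
  have := nonempty_of_mem (p e).mem
  rw [← h.image_label hp] at this
  exact Finset.image_nonempty.1 this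

/-- For the converse, `p e` is lifted to a point `x` below `e'`; then `e` and `x` lie over the same
simplex and above a common vertex, so they coincide. -/
theorem IsVertexSet.specializes_iff (hp : IsCovering p) {t t' : Finset (MinimalLift p)} {e e' : E}
    (h : IsVertexSet t e) (h' : IsVertexSet t' e') : e ⤳ e' ↔ t ⊆ t' := by
  constructor
  · exact fun hee' w hw => (h' w).2 (((h w).1 hw).trans hee')
  · intro htt'
    have hle : p e ⤳ p e' := by
      rw [FacePoset.specializes_iff, ← h.image_label hp, ← h'.image_label hp]
      exact Finset.image_subset_image htt'
    obtain ⟨x, hx, hxe⟩ := hp.exists_lift_below hle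
    obtain ⟨w, hw⟩ := h.nonempty hp
    have hwe := (h w).1 hw
    have hwx : w.val ⤳ x := MinimalLift.specializes_of_below hp ((h' w).1 (htt' hw)) hx
      (hxe ▸ MinimalLift.label_mem hp hwe)
    rwa [hp.eq_of_above hwe hwx hxe.symm]

/-- The complex of vertex sets of elements of the total space. -/
def minimalComplex (hp : IsCovering p) : AbstractSimplicialComplex (MinimalLift p) where
  faces := {t | ∃ e, IsVertexSet t e}
  isRelLowerSet_faces := by
    rintro t ⟨e, he⟩
    refine ⟨he.nonempty hp, fun r hrt hr => ?_⟩
    have hsub : r.image MinimalLift.label ⊆ (p e).simplex :=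
      he.image_label hp ▸ Finset.image_subset_image hrt
    -- The face `r` is the vertex set of the point `x` below `e` over the simplex of labels of `r`.
    obtain ⟨x, hx, hxr⟩ := hp.exists_lift_below (e := e)
      (b := ⟨_, mem_of_subset (p e).mem hsub (hr.image _)⟩) (FacePoset.specializes_iff.2 hsub)
    refine ⟨x, fun w => ⟨fun hw => ?_, fun hw => ?_⟩⟩
    · exact MinimalLift.specializes_of_below hp ((he w).1 (hrt hw)) hx
        (hxr ▸ Finset.mem_image_of_mem _ hw)
    · have hl := MinimalLift.label_mem hp hw
      rw [hxr] at hl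
      obtain ⟨w', hw', h⟩ := Finset.mem_image.1 hl
      rwa [← MinimalLift.eq_of_below hp ((he w').1 (hrt hw')) (hw.trans hx) h]
  singleton_mem w := by
    refine ⟨w.val, fun w' => ?_⟩
    rw [Finset.mem_singleton]
    constructor
    · rintro rfl
      exact specializes_rfl
    · intro h
      refine MinimalLift.eq_of_below hp h specializes_rfl ?_
      have := MinimalLift.label_mem hp h
      rw [w.map_val] at this
      exact Finset.mem_singleton.1 this

/-- The projection of the complex of vertex sets. -/
noncomputable def minimalMap (hp : IsCovering p) : SimplicialMap (minimalComplex hp) K where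
  toFun := MinimalLift.label
  image_mem := by
    rintro t ⟨e, he⟩
    rw [he.image_label hp]
    exact (p e).mem

theorem isCombCovering_minimalMap (hp : IsCovering p) : IsCombCovering (minimalMap hp) where
  surjective v := by
    obtain ⟨e, he⟩ := hp.2 (FacePoset.vertex K v)
    exact ⟨⟨e, v, he⟩, MinimalLift.label_eq _ he⟩
  injOn := by
    rintro t ⟨e, he⟩ w hw w' hw' h
    exact MinimalLift.eq_of_below hp ((he w).1 hw) ((he w').1 hw') h
  exists_lift w s hs hws := by
    obtain ⟨e, hwe, he⟩ := hp.exists_lift_above (e := w.val) (b := ⟨s, hs⟩) (by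
      rw [w.map_val]
      exact FacePoset.vertex_specializes_iff.2 hws)
    obtain ⟨t, ht⟩ := exists_isVertexSet hp e
    exact ⟨t, ⟨e, ht⟩, (ht w).2 hwe, (ht.image_label hp).trans (congrArg FacePoset.simplex he)⟩
  lift_unique := by
    rintro w t ⟨e, he⟩ t' ⟨e', he'⟩ hwt hwt' h
    have hpe : p e = p e' := FacePoset.ext ((he.image_label hp).symm.trans
      (Eq.trans h (he'.image_label hp)))
    obtain rfl := hp.eq_of_above ((he w).1 hwt) ((he' w).1 hwt') hpe
    ext x
    rw [he x, he' x]

/-- An element and its vertex set determine each other, compatibly with the orders; between A-spaces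
an order isomorphism is a homeomorphism. -/
theorem exists_minimalMap_homeomorph (hp : IsCovering p) :
    ∃ k : FacePoset (minimalComplex hp) ≃ₜ E, ∀ t, p (k t) = (minimalMap hp).facePoset t := by
  have := hp.alexandrovDiscrete
  choose k hk using fun t : FacePoset (minimalComplex hp) => t.mem
  choose f hf using exists_isVertexSet hp
  have hpk : ∀ t, p (k t) = (minimalMap hp).facePoset t := fun t =>
    FacePoset.ext ((hk t).image_label hp).symm
  refine ⟨⟨⟨k, fun e => ⟨f e, e, hf e⟩, fun t => ?_, fun e => ?_⟩, ?_, ?_⟩, hpk⟩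
  · refine FacePoset.ext ?_
    ext w
    exact (hf (k t) w).trans (hk t w).symm
  · have hvs := hk ⟨f e, e, hf e⟩
    obtain ⟨w, hw⟩ := hvs.nonempty hp
    refine hp.eq_of_above ((hvs w).1 hw) ((hf e w).1 hw) (FacePoset.ext ?_)
    rw [← hvs.image_label hp, ← (hf e).image_label hp]
  · exact continuous_of_specializes fun t t' h =>
      ((hk t).specializes_iff hp (hk t')).2 (FacePoset.specializes_iff.1 h)
  · exact continuous_of_specializes fun e e' h =>
      FacePoset.specializes_iff.2 (((hf e).specializes_iff hp (hf e')).1 h)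

end Reconstruction

/-- `Φ` uses a chosen simplicial representative of each class. The choice is harmless, and `Φ` is
injective, because equivalence on either side amounts to `IsoOver`. -/
theorem facePoset_bijection (K : AbstractSimplicialComplex V) :
    ∃ Φ : CoveringClass.{u, v} (Realization K) → CoveringClass.{u, v} (FacePoset K),
      Bijective Φ ∧ ∀ (W : Type v) (L : AbstractSimplicialComplex W) (φ : SimplicialMap L K)
        (hφ : IsCovering φ.realization) (hXφ : IsCovering φ.facePoset),
        Φ (CoveringClass.mk φ.realization hφ) = CoveringClass.mk φ.facePoset hXφ := by
  choose W L φ hφ hc using exists_simplicial_covering.{u, v} (K := K)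
  have hcomb := fun c => isCombCovering_of_isCovering (hφ c)
  have hΦ : ∀ (W' : Type v) (L' : AbstractSimplicialComplex W') (φ' : SimplicialMap L' K)
      (hφ' : IsCovering φ'.realization) (hXφ' : IsCovering φ'.facePoset),
      CoveringClass.mk (φ (CoveringClass.mk φ'.realization hφ')).facePoset
        (hcomb _).isCovering_facePoset = CoveringClass.mk φ'.facePoset hXφ' :=
    fun W' L' φ' hφ' hXφ' =>
      (mk_facePoset_eq_iff (hcomb _) (isCombCovering_of_isCovering hφ') _ _).2
        ((mk_realization_eq_iff (hφ _) hφ').1 (hc _))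
  refine ⟨fun c => CoveringClass.mk (φ c).facePoset (hcomb c).isCovering_facePoset,
    ⟨fun c c' h => ?_, fun c => ?_⟩, hΦ⟩
  · rw [← hc c, ← hc c']
    exact (mk_realization_eq_iff _ _).2 ((mk_facePoset_eq_iff (hcomb c) (hcomb c') _ _).1 h)
  · induction c using Quotient.ind with | _ c
    have hmin := isCombCovering_minimalMap c.isCovering
    refine ⟨CoveringClass.mk _ hmin.isCovering,
      (hΦ _ _ _ hmin.isCovering hmin.isCovering_facePoset).trans ?_⟩
    exact Quotient.sound (exists_minimalMap_homeomorph c.isCovering)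

end FacePoset

end PosetCov

theorem theoremA10 :
    -- the order complex functor
    (∀ (B : Type u) [TopologicalSpace B] [AlexandrovDiscrete B] [T0Space B],
      (∀ (E : Type v) [TopologicalSpace E] (p : C(E, B)), IsCovering p →
        AlexandrovDiscrete E ∧ T0Space E ∧ IsCovering (orderComplexMap p).realization) ∧
      ∃ Φ : CoveringClass.{u, v} B → CoveringClass.{u, v} (Realization (orderComplex B)),
        Function.Bijective Φ ∧
        ∀ (E : Type v) [TopologicalSpace E] (p : C(E, B)) (hp : IsCovering p)
          (hKp : IsCovering (orderComplexMap p).realization),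
          Φ (CoveringClass.mk p hp) = CoveringClass.mk (orderComplexMap p).realization hKp) ∧
    -- the face poset functor
    (∀ (V : Type u) (K : AbstractSimplicialComplex V),
      (∀ (W : Type v) (L : AbstractSimplicialComplex W) (φ : SimplicialMap L K),
        IsCovering φ.realization → IsCovering φ.facePoset) ∧
      (∀ c : CoveringClass.{u, v} (Realization K),
        ∃ (W : Type v) (L : AbstractSimplicialComplex W) (φ : SimplicialMap L K)
          (hφ : IsCovering φ.realization), CoveringClass.mk φ.realization hφ = c) ∧
      ∃ Φ : CoveringClass.{u, v} (Realization K) → CoveringClass.{u, v} (FacePoset K),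
        Function.Bijective Φ ∧
        ∀ (W : Type v) (L : AbstractSimplicialComplex W) (φ : SimplicialMap L K)
          (hφ : IsCovering φ.realization) (hXφ : IsCovering φ.facePoset),
          Φ (CoveringClass.mk φ.realization hφ) = CoveringClass.mk φ.facePoset hXφ) := by
  refine ⟨fun B _ _ _ => ⟨fun E _ p hp => ?_, orderComplex_bijection B⟩, fun V K =>
    ⟨fun W L φ hφ => ?_, exists_simplicial_covering, facePoset_bijection K⟩⟩
  · exact ⟨hp.alexandrovDiscrete, hp.t0Space, hp.orderComplexMap⟩
  · exact (isCombCovering_of_isCovering hφ).isCovering_facePoset
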